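/- \textbf{Conventions.} Let $\mathcal L$ be the class of equations $u_t+C(t,x)\,u\,u_x=A^2(t,x)\,u_{xx}$, where $A^2$ and $C$ are smooth real functions with $A^2C\neq0$ (the $2$ in $A^2$, the $1$ in $U^1$ and the $0$ in $U^0$ are upper indices, not powers). Let $D\subset\mathbb R^3$ be a connected open set of points $(t,x,u)$ whose sections by $t=\mathrm{const}$ and by $(t,x)=\mathrm{const}$ are connected or empty (for example, a convex open set). A point transformation $\varphi\colon(t,x,u)\mapsto(\tilde t,\tilde x,\tilde u)$ is a smooth diffeomorphism of $D$ onto an open subset of $\mathbb R^3$. The coefficients of the source (resp. target) equation are defined on the projection of $D$ (resp. $\varphi(D)$) to the plane of $(t,x)$ (resp. $(\tilde t,\tilde x)$). We say that $\varphi$ connects two equations if its prolongation to 2-jets of functions, wherever defined, maps the submanifold of the second-order jet space given by the source equation to the one given by the target equation: if $\varphi$ maps the graph of a smooth $u$ near a point to the graph of a smooth $\tilde u$, then $u$ satisfies the source equation at that point if and only if $\tilde u$ satisfies the target equation at the image point. \textbf{Proposition.} Let an equation of the class $\mathcal L$ with arbitrary elements $(A^2,C)$ and a point transformation $\varphi$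 on $D$ be given. Then $\varphi$ connects this equation to some equation $\tilde u_{\tilde t}+\tilde C\tilde u\tilde u_{\tilde x}=\tilde A^2\tilde u_{\tilde x\tilde x}$ of the class $\mathcal L$ if and only if $\varphi$ is of the form $$\tilde t=T(t),\qquad \tilde x=X(t,x),\qquad \tilde u=U^1(t)\,u+U^0(t,x),$$ where $T$, $X$, $U^1$ and $U^0$ are smooth functions of their arguments with $T_tX_xU^1\neq0$ that satisfy $$X_t=A^2X_{xx}+\frac{U^0C}{U^1}X_x,\qquad C\,U^0_x=-U^1_t,\qquad U^0_t=A^2U^0_{xx}.$$ In this case, the equations of $\mathcal L$ to which $\varphi$ connects the given one are exactly those with $$\tilde C(T(t),X(t,x))=\frac{X_x}{T_tU^1}\,C(t,x),\qquad \tilde A^2(T(t),X(t,x))=\frac{X_x^2}{T_t}\,A^2(t,x)$$ for all $(t,x)$ in the projection of $D$. -/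

import Mathlib

open Set Filter Topology
open scoped ContDiff

namespace VarBurgers

/-- Coordinates `(t, x)`. -/
abbrev Base : Type := ℝ × ℝ

/-- Coordinates `(t, x, u)`. -/
abbrev Total : Type := ℝ × ℝ × ℝ

/-- The projection `(t, x, u) ↦ (t, x)`. -/
def base (p : Total) : Base := (p.1, p.2.1)

/-- The point `(t, x, u (t, x))` of the graph of `u` over `(t, x)`. -/
def graphPt (u : Base → ℝ) (z : Base) : Total := (z.1, z.2, u z)

/-- The partial derivative with respect to `t`. -/
noncomputable def dt (f : Base → ℝ) (z : Base) : ℝ := deriv (fun s => f (s, z.2)) z.1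

/-- The partial derivative with respect to `x`. -/
noncomputable def dx (f : Base → ℝ) (z : Base) : ℝ := deriv (fun y => f (z.1, y)) z.2

/-- A tuple of arbitrary elements `(A², C)`; the `2` in `A2` is an upper index, not a power. -/
structure Coeffs where
  A2 : Base → ℝ
  C : Base → ℝ

/-- Over the set `Ω` of points `(t, x)`, the pair `(A², C)` is smooth with `A² C ≠ 0`,
that is, `u_t + C u u_x = A² u_xx` belongs to the class. -/
structure Coeffs.InClass (θ : Coeffs) (Ω : Set Base) : Prop where
  smooth_A2 : ContDiffOn ℝ ∞ θ.A2 Ω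
  smooth_C : ContDiffOn ℝ ∞ θ.C Ω
  ne_zero : ∀ z ∈ Ω, θ.A2 z * θ.C z ≠ 0

/-- The function `u` satisfies `u_t + C u u_x = A² u_xx` at the point `z`; equivalently,
the 2-jet of `u` at `z` belongs to the submanifold of the second-order jet space
that is defined by the equation. -/
def Coeffs.SatisfiedAt (θ : Coeffs) (u : Base → ℝ) (z : Base) : Prop :=
  dt u z + θ.C z * u z * dx u z = θ.A2 z * dx (dx u) z

/-- A domain of the space with coordinates `(t, x, u)` whose sections by `t = const` and by
`(t, x) = const` are connected or empty (every convex open set and every open box is one), so that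
functions on it that do not depend on `(x, u)`, or on `u`, to first order are functions of `t`,
or of `(t, x)`. -/
structure IsFibredDomain (D : Set Total) : Prop where
  isOpen : IsOpen D
  isPreconnected : IsPreconnected D
  slice : ∀ t : ℝ, IsPreconnected {q : ℝ × ℝ | (t, q.1, q.2) ∈ D}
  fibre : ∀ t x : ℝ, IsPreconnected {u : ℝ | (t, x, u) ∈ D}

/-- `φ` is a point transformation defined on `D`: smooth, injective, and with nowhere vanishing
Jacobian, that is, a diffeomorphism of `D` onto the open set `φ '' D`. -/
structure IsPointTransformation (D : Set Total) (φ : Total → Total) : Prop where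
  smooth : ContDiffOn ℝ ∞ φ D
  injOn : InjOn φ D
  jacobian : ∀ p ∈ D, (fderiv ℝ φ p).det ≠ 0

/-- Near the point over `z`, `φ` maps the graph of `u` (which lies in `D` there) into the
graph of `v`; here `u` and `v` are smooth near the points concerned. Thus the second prolongation
of `φ` takes the 2-jet of `u` at `z` to the 2-jet of `v` at `base (φ (graphPt u z))`. -/
structure MapsGraph (D : Set Total) (φ : Total → Total) (u v : Base → ℝ) (z : Base) : Prop where
  mem : graphPt u z ∈ D
  smooth_source : ContDiffAt ℝ ∞ u z
  smooth_target : ContDiffAt ℝ ∞ v (base (φ (graphPt u z)))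
  graph : ∀ᶠ w in 𝓝 z, φ (graphPt u w) = graphPt v (base (φ (graphPt u w)))

/-- `φ` connects the equations with arbitrary elements `θ` and `θ'`: the prolongation of `φ` to
2-jets maps the submanifold of the second-order jet space defined by the first equation to the one
defined by the second, wherever this prolongation is defined. -/
def Connects (D : Set Total) (φ : Total → Total) (θ θ' : Coeffs) : Prop :=
  ∀ (u v : Base → ℝ) (z : Base), MapsGraph D φ u v z →
    (θ.SatisfiedAt u z ↔ θ'.SatisfiedAt v (base (φ (graphPt u z))))

/-- On `D`, `φ` is `(t, x, u) ↦ (T(t), X(t,x), U¹(t) u + U⁰(t,x))` with smooth `T`, `X`, `U¹`, `U⁰`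
such that `T_t X_x U¹ ≠ 0`. -/
structure HasForm (D : Set Total) (φ : Total → Total)
    (T : ℝ → ℝ) (X : Base → ℝ) (U1 : ℝ → ℝ) (U0 : Base → ℝ) : Prop where
  smooth_T : ContDiffOn ℝ ∞ T (Prod.fst '' D)
  smooth_X : ContDiffOn ℝ ∞ X (base '' D)
  smooth_U1 : ContDiffOn ℝ ∞ U1 (Prod.fst '' D)
  smooth_U0 : ContDiffOn ℝ ∞ U0 (base '' D)
  ne_zero : ∀ z ∈ base '' D, deriv T z.1 * dx X z * U1 z.1 ≠ 0
  eq : ∀ t x u : ℝ, (t, x, u) ∈ D → φ (t, x, u) = (T t, X (t, x), U1 t * u + U0 (t, x))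

/-- The determining equations for the parameters of the transformation, over the set `Ω`. -/
structure Determining (θ : Coeffs) (Ω : Set Base)
    (X : Base → ℝ) (U1 : ℝ → ℝ) (U0 : Base → ℝ) : Prop where
  eq_X : ∀ z ∈ Ω, dt X z = θ.A2 z * dx (dx X) z + U0 z * θ.C z / U1 z.1 * dx X z
  eq_U1 : ∀ z ∈ Ω, θ.C z * dx U0 z = -deriv U1 z.1
  eq_U0 : ∀ z ∈ Ω, dt U0 z = θ.A2 z * dx (dx U0) z

/-- The relations between source and target arbitrary elements, over the set `Ω`: the target ones
are evaluated at the new variables, the source ones at the old variables. -/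
structure Related (θ θ' : Coeffs) (Ω : Set Base)
    (T : ℝ → ℝ) (X : Base → ℝ) (U1 : ℝ → ℝ) : Prop where
  eq_C : ∀ z ∈ Ω, θ'.C (T z.1, X z) = dx X z / (deriv T z.1 * U1 z.1) * θ.C z
  eq_A2 : ∀ z ∈ Ω, θ'.A2 (T z.1, X z) = dx X z ^ 2 / deriv T z.1 * θ.A2 z

end VarBurgers

/-! Write `φ = (P, Q, R)`. Every necessary condition comes from testing `Connects` on quadratic
functions `quad` that satisfy the source equation at a point, and comparing the target equations
that result. Existence of the transformed function only needs the total Jacobian `D_t P D_x Q - D_x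
P D_t Q` to be nonzero.

Changing `u_tt` alone affects neither the source equation nor the first derivatives of the image
`v`; the target equation, with nonzero `A²`, then fixes `v_xx` too. The second-order chain rule
along the direction killed by the total differential of `P` gives `D_x P = 0`
(`Connects.total_dx_time_eq_zero`), hence `P_x = P_u = 0` (`Connects.time_only`). Changing `u_xx`
and `u_t` along the source equation gives `Ã² P_t = A² (D_x Q)²` (`Connects.A2_relation`), where
dependence on `u_x` is impossible, so `Q_u = 0` (`Connects.space_projectable`). A second difference
in `u_x` gives `R_uu = 0` (`Connects.affine_in_u`).

Connectedness of the sections of `D` turns these pointwise conditions into a global form affine in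
`u` (`Connects.exists_isAffineForm`). Splitting the transformed equation in `u_xx`, `u_x` and `u`
yields `U¹_x = 0`, the determining equations and the formulas for the new coefficients
(`Connects.determining`).

Conversely, these relations make `T_t` times the target equation equal to `U¹` times the source
equation (`IsAffineForm.satisfiedAt_iff`). The formulas do define an equation of the class, because
`(T, X)` is injective with smooth inverse (`HasForm.injOn`, `HasForm.exists_related`). -/

namespace VarBurgers

/-! ### Calculus of directional derivatives. -/

section DirectionalDerivative

variable {E : Type*} [NormedAddCommGroup E] [NormedSpace ℝ E]

/-- The derivative of `f` in the direction `e`. -/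
noncomputable def pd (e : E) (f : E → ℝ) (z : E) : ℝ := fderiv ℝ f z e

lemma pd_congr {e : E} {f g : E → ℝ} {z : E} (h : f =ᶠ[𝓝 z] g) : pd e f z = pd e g z := by
  rw [pd, pd, h.fderiv_eq]

lemma pd_eventuallyEq {e : E} {f g : E → ℝ} {z : E} (h : f =ᶠ[𝓝 z] g) :
    pd e f =ᶠ[𝓝 z] pd e g := by
  filter_upwards [h.fderiv (𝕜 := ℝ)] with w hw
  rw [pd, pd, hw]

lemma pd_add {e : E} {f g : E → ℝ} {z : E} (hf : DifferentiableAt ℝ f z)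
    (hg : DifferentiableAt ℝ g z) : pd e (fun w => f w + g w) z = pd e f z + pd e g z := by
  simp [pd, fderiv_fun_add hf hg]

lemma pd_mul {e : E} {f g : E → ℝ} {z : E} (hf : DifferentiableAt ℝ f z)
    (hg : DifferentiableAt ℝ g z) :
    pd e (fun w => f w * g w) z = pd e f z * g z + f z * pd e g z := by
  simp [pd, fderiv_fun_mul hf hg]
  ring

lemma pd_const_mul {e : E} {f : E → ℝ} {z : E} (c : ℝ) (hf : DifferentiableAt ℝ f z) :
    pd e (fun w => c * f w) z = c * pd e f z := by
  simp [pd, fderiv_const_mul hf]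

lemma contDiffAt_pd {e : E} {f : E → ℝ} {z : E} {n m : WithTop ℕ∞} (hf : ContDiffAt ℝ n f z)
    (h : m + 1 ≤ n) : ContDiffAt ℝ m (pd e f) z :=
  (hf.fderiv_right h).clm_apply contDiffAt_const

lemma eventually_contDiffAt_two {f : E → ℝ} {z : E} (hf : ContDiffAt ℝ 2 f z) :
    ∀ᶠ w in 𝓝 z, ContDiffAt ℝ 2 f w :=
  hf.eventually (by simp)

lemma differentiableAt_of_two {f : E → ℝ} {z : E} (hf : ContDiffAt ℝ 2 f z) :
    DifferentiableAt ℝ f z := hf.differentiableAt (by simp)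

lemma differentiableAt_pd {e : E} {f : E → ℝ} {z : E} (hf : ContDiffAt ℝ 2 f z) :
    DifferentiableAt ℝ (pd e f) z :=
  (contDiffAt_pd (m := 1) hf (by norm_num)).differentiableAt (by simp)

lemma pd_pd_comm (e e' : E) {f : E → ℝ} {z : E} (hf : ContDiffAt ℝ 2 f z) :
    pd e (pd e' f) z = pd e' (pd e f) z := by
  have hd : DifferentiableAt ℝ (fderiv ℝ f) z :=
    (hf.fderiv_right (m := 1) (by norm_num)).differentiableAt (by simp)
  have key : ∀ a b : E, pd a (pd b f) z = fderiv ℝ (fderiv ℝ f) z a b := by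
    intro a b
    have : HasFDerivAt (pd b f) _ z := hd.hasFDerivAt.clm_apply (hasFDerivAt_const b z)
    rw [pd, this.fderiv]
    simp
  rw [key, key]
  exact (hf.isSymmSndFDerivAt (by simp)) e e'

end DirectionalDerivative

/-! ### Chain rules in coordinates, to second order. -/

/-- Directions of the coordinate axes. -/
abbrev et : Base := (1, 0)
abbrev ex : Base := (0, 1)
abbrev Et : Total := (1, 0, 0)
abbrev Ex : Total := (0, 1, 0)
abbrev Eu : Total := (0, 0, 1)

lemma clm_base (L : Base →L[ℝ] ℝ) (e : Base) : L e = e.1 * L et + e.2 * L ex := by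
  have : e = e.1 • et + e.2 • ex := by ext <;> simp
  calc L e = L (e.1 • et + e.2 • ex) := congrArg L this
    _ = _ := by simp only [map_add, map_smul, smul_eq_mul]

lemma clm_total (L : Total →L[ℝ] ℝ) (e : Total) :
    L e = e.1 * L Et + e.2.1 * L Ex + e.2.2 * L Eu := by
  have : e = e.1 • Et + e.2.1 • Ex + e.2.2 • Eu := by ext <;> simp
  calc L e = L (e.1 • Et + e.2.1 • Ex + e.2.2 • Eu) := congrArg L this
    _ = _ := by simp only [map_add, map_smul, smul_eq_mul]

lemma pd_comp_pair {E : Type*} [NormedAddCommGroup E] [NormedSpace ℝ E] {e : E} {v : Base → ℝ}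
    {f g : E → ℝ} {z : E} (hv : DifferentiableAt ℝ v (f z, g z)) (hf : DifferentiableAt ℝ f z)
    (hg : DifferentiableAt ℝ g z) :
    pd e (fun w => v (f w, g w)) z =
      pd et v (f z, g z) * pd e f z + pd ex v (f z, g z) * pd e g z := by
  have h := (hv.hasFDerivAt.comp z (hf.hasFDerivAt.prodMk hg.hasFDerivAt)).fderiv
  have h2 : pd e (fun w => v (f w, g w)) z = fderiv ℝ v (f z, g z) (pd e f z, pd e g z) := by
    have := congrArg (fun L => L e) h
    simpa [pd, Function.comp_def] using this
  rw [h2, clm_base]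
  simp only [pd]
  ring

/-- Differentiates `R = v(P, Q)` twice along a graph. Agreement of germs suffices, and it is all
that `MapsGraph` provides. -/
lemma pd_pd_comp_pair {e e' : Base} {v h f g : Base → ℝ} {z : Base}
    (hv : ContDiffAt ℝ 2 v (f z, g z)) (hf : ContDiffAt ℝ 2 f z) (hg : ContDiffAt ℝ 2 g z)
    (hh : h =ᶠ[𝓝 z] fun w => v (f w, g w)) :
    pd e' (pd e h) z =
      (pd et (pd et v) (f z, g z) * pd e' f z + pd ex (pd et v) (f z, g z) * pd e' g z) * pd e f z
      + pd et v (f z, g z) * pd e' (pd e f) z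
      + (pd et (pd ex v) (f z, g z) * pd e' f z + pd ex (pd ex v) (f z, g z) * pd e' g z) * pd e g z
      + pd ex v (f z, g z) * pd e' (pd e g) z := by
  have hc : Tendsto (fun w => (f w, g w)) (𝓝 z) (𝓝 (f z, g z)) :=
    hf.continuousAt.prodMk hg.continuousAt
  have h1 : pd e h =ᶠ[𝓝 z] fun w =>
      pd et v (f w, g w) * pd e f w + pd ex v (f w, g w) * pd e g w := by
    filter_upwards [pd_eventuallyEq (e := e) hh, eventually_contDiffAt_two hf,
      eventually_contDiffAt_two hg, hc.eventually (eventually_contDiffAt_two hv)] with w h1 h2 h3 h4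
    rw [h1, pd_comp_pair (differentiableAt_of_two h4) (differentiableAt_of_two h2)
      (differentiableAt_of_two h3)]
  have df := differentiableAt_of_two hf
  have dg := differentiableAt_of_two hg
  have dv : ∀ d : Base, DifferentiableAt ℝ (fun w => pd d v (f w, g w)) z := fun d =>
    DifferentiableAt.comp (f := fun w => (f w, g w)) z (differentiableAt_pd (e := d) hv)
      (df.prodMk dg)
  have dpf := differentiableAt_pd (e := e) hf
  have dpg := differentiableAt_pd (e := e) hg
  rw [pd_congr h1, pd_add ((dv et).fun_mul dpf) ((dv ex).fun_mul dpg), pd_mul (dv et) dpf,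
    pd_mul (dv ex) dpg, pd_comp_pair (differentiableAt_pd hv) df dg,
    pd_comp_pair (differentiableAt_pd hv) df dg]
  ring

lemma contDiffAt_graphPt {n : WithTop ℕ∞} {u : Base → ℝ} {z : Base} (hu : ContDiffAt ℝ n u z) :
    ContDiffAt ℝ n (graphPt u) z :=
  contDiffAt_fst.prodMk (contDiffAt_snd.prodMk hu)

lemma pd_comp_graphPt {e : Base} {F : Total → ℝ} {u : Base → ℝ} {z : Base}
    (hF : DifferentiableAt ℝ F (graphPt u z)) (hu : DifferentiableAt ℝ u z) :
    pd e (fun w => F (graphPt u w)) z =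
      e.1 * pd Et F (graphPt u z) + e.2 * pd Ex F (graphPt u z)
        + pd e u z * pd Eu F (graphPt u z) := by
  have hg : HasFDerivAt (graphPt u) _ z :=
    hasFDerivAt_fst.prodMk (hasFDerivAt_snd.prodMk hu.hasFDerivAt)
  have h := (hF.hasFDerivAt.comp z hg).fderiv
  have h2 : pd e (fun w => F (graphPt u w)) z =
      fderiv ℝ F (graphPt u z) (e.1, e.2, pd e u z) := by
    have := congrArg (fun L => L e) h
    simpa [pd, Function.comp_def] using this
  rw [h2, clm_total]
  simp only [pd]

/-- Iterated total derivatives: along a graph, direction `e` becomes `e.1 ∂_t + e.2 ∂_x + (∂_e u)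
∂_u`. -/
lemma pd_pd_comp_graphPt {e e' : Base} {F : Total → ℝ} {u : Base → ℝ} {z : Base}
    (hF : ContDiffAt ℝ 2 F (graphPt u z)) (hu : ContDiffAt ℝ 2 u z) :
    pd e' (pd e (fun w => F (graphPt u w))) z =
      e.1 * (e'.1 * pd Et (pd Et F) (graphPt u z) + e'.2 * pd Ex (pd Et F) (graphPt u z)
        + pd e' u z * pd Eu (pd Et F) (graphPt u z))
      + e.2 * (e'.1 * pd Et (pd Ex F) (graphPt u z) + e'.2 * pd Ex (pd Ex F) (graphPt u z)
        + pd e' u z * pd Eu (pd Ex F) (graphPt u z))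
      + pd e u z * (e'.1 * pd Et (pd Eu F) (graphPt u z) + e'.2 * pd Ex (pd Eu F) (graphPt u z)
        + pd e' u z * pd Eu (pd Eu F) (graphPt u z))
      + pd e' (pd e u) z * pd Eu F (graphPt u z) := by
  have hc : Tendsto (graphPt u) (𝓝 z) (𝓝 (graphPt u z)) := (contDiffAt_graphPt hu).continuousAt
  have h1 : pd e (fun w => F (graphPt u w)) =ᶠ[𝓝 z] fun w =>
      (e.1 * pd Et F (graphPt u w) + e.2 * pd Ex F (graphPt u w))
        + pd e u w * pd Eu F (graphPt u w) := by
    filter_upwards [eventually_contDiffAt_two hu,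
      hc.eventually (eventually_contDiffAt_two hF)] with w h2 h4
    rw [pd_comp_graphPt (differentiableAt_of_two h4) (differentiableAt_of_two h2)]
  have du := differentiableAt_of_two hu
  have dF : ∀ d : Total, DifferentiableAt ℝ (fun w => pd d F (graphPt u w)) z := fun d =>
    DifferentiableAt.comp z (differentiableAt_pd (e := d) hF)
      ((contDiffAt_graphPt hu).differentiableAt (by simp))
  have dpu := differentiableAt_pd (e := e) hu
  rw [pd_congr h1, pd_add (((dF _).const_mul _).fun_add ((dF _).const_mul _)) (dpu.fun_mul (dF _)),
    pd_add ((dF _).const_mul _) ((dF _).const_mul _), pd_const_mul _ (dF _),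
    pd_const_mul _ (dF _), pd_mul dpu (dF _), pd_comp_graphPt (differentiableAt_pd hF) du,
    pd_comp_graphPt (differentiableAt_pd hF) du, pd_comp_graphPt (differentiableAt_pd hF) du]
  ring

/-! ### Comparison of the one-variable partial derivatives with directional ones. -/

lemma dt_eq_pd {f : Base → ℝ} {z : Base} (hf : DifferentiableAt ℝ f z) : dt f z = pd et f z := by
  have h1 : HasDerivAt (fun s : ℝ => (s, z.2)) ((1, 0) : Base) z.1 :=
    (hasDerivAt_id z.1).prodMk (hasDerivAt_const z.1 z.2)
  exact (HasFDerivAt.comp_hasDerivAt (f := fun s : ℝ => (s, z.2)) z.1 hf.hasFDerivAt h1).deriv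

lemma dx_eq_pd {f : Base → ℝ} {z : Base} (hf : DifferentiableAt ℝ f z) : dx f z = pd ex f z := by
  have h1 : HasDerivAt (fun s : ℝ => (z.1, s)) ((0, 1) : Base) z.2 :=
    (hasDerivAt_const z.2 z.1).prodMk (hasDerivAt_id z.2)
  exact (HasFDerivAt.comp_hasDerivAt (f := fun s : ℝ => (z.1, s)) z.2 hf.hasFDerivAt h1).deriv

lemma dx_congr {f g : Base → ℝ} {z : Base} (h : f =ᶠ[𝓝 z] g) : dx f z = dx g z := by
  have hc : Tendsto (fun y : ℝ => (z.1, y)) (𝓝 z.2) (𝓝 z) :=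
    (Continuous.prodMk_right z.1).tendsto' _ _ rfl
  exact Filter.EventuallyEq.deriv_eq (hc.eventually h)

lemma dx_dx_eq_pd {f : Base → ℝ} {z : Base} (hf : ContDiffAt ℝ 2 f z) :
    dx (dx f) z = pd ex (pd ex f) z := by
  have h : dx f =ᶠ[𝓝 z] pd ex f := by
    filter_upwards [eventually_contDiffAt_two hf] with w hw
    exact dx_eq_pd (differentiableAt_of_two hw)
  rw [dx_congr h, dx_eq_pd (differentiableAt_pd hf)]

lemma Coeffs.satisfiedAt_iff {θ : Coeffs} {u : Base → ℝ} {z : Base} (hu : ContDiffAt ℝ 2 u z) :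
    θ.SatisfiedAt u z ↔
      pd et u z + θ.C z * u z * pd ex u z = θ.A2 z * pd ex (pd ex u) z := by
  rw [Coeffs.SatisfiedAt, dx_dx_eq_pd hu, dt_eq_pd (differentiableAt_of_two hu),
    dx_eq_pd (differentiableAt_of_two hu)]

/-! ### Local inversion of plane maps. -/

/-- A linear endomorphism of the plane with nonzero determinant, as an equivalence. -/
lemma exists_equiv_of_det_ne_zero (L : Base →L[ℝ] Base)
    (h : (L et).1 * (L ex).2 - (L ex).1 * (L et).2 ≠ 0) :
    ∃ L' : Base ≃L[ℝ] Base, (L' : Base →L[ℝ] Base) = L := by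
  have hker : LinearMap.ker (L : Base →ₗ[ℝ] Base) = ⊥ := by
    refine LinearMap.ker_eq_bot'.2 fun e he => ?_
    have h1 := clm_base ((ContinuousLinearMap.fst ℝ ℝ ℝ).comp L) e
    have h2 := clm_base ((ContinuousLinearMap.snd ℝ ℝ ℝ).comp L) e
    have he' : L e = 0 := he
    simp only [ContinuousLinearMap.comp_apply, he', ContinuousLinearMap.coe_fst',
      ContinuousLinearMap.coe_snd', Prod.fst_zero, Prod.snd_zero] at h1 h2
    have e1 : e.1 = 0 := by
      refine (mul_eq_zero.1 (?_ : e.1 * _ = 0)).resolve_right h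
      linear_combination -(L ex).2 * h1 + (L ex).1 * h2
    have e2 : e.2 = 0 := by
      refine (mul_eq_zero.1 (?_ : e.2 * _ = 0)).resolve_right h
      linear_combination (L et).2 * h1 - (L et).1 * h2
    exact Prod.ext e1 e2
  refine ⟨(LinearEquiv.ofInjectiveEndo (L : Base →ₗ[ℝ] Base)
    (LinearMap.ker_eq_bot.1 hker)).toContinuousLinearEquiv, ?_⟩
  ext <;> rfl

/-- The inverse function theorem for a smooth map of the plane given by its components. -/
lemma exists_local_inverse {f g : Base → ℝ} {z : Base} (hf : ContDiffAt ℝ ∞ f z)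
    (hg : ContDiffAt ℝ ∞ g z) (hJ : pd et f z * pd ex g z - pd ex f z * pd et g z ≠ 0) :
    ∃ σ : Base → Base, ContDiffAt ℝ ∞ σ (f z, g z) ∧ σ (f z, g z) = z ∧
      (∀ᶠ w in 𝓝 z, σ (f w, g w) = w) ∧
      ∀ᶠ y in 𝓝 (f z, g z), (f (σ y), g (σ y)) = y := by
  have hfg : ContDiffAt ℝ ∞ (fun w => (f w, g w)) z := hf.prodMk hg
  have hd := (hf.differentiableAt (by simp)).hasFDerivAt.prodMk
    (hg.differentiableAt (by simp)).hasFDerivAt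
  obtain ⟨L', hL'⟩ := exists_equiv_of_det_ne_zero ((fderiv ℝ f z).prod (fderiv ℝ g z))
    (by simpa [pd] using hJ)
  rw [← hL'] at hd
  have hs := hfg.hasStrictFDerivAt' hd (by simp)
  exact ⟨hfg.localInverse hd (by simp), hfg.to_localInverse hd (by simp),
    hfg.localInverse_apply_image hd (by simp), hs.eventually_left_inverse,
    hs.eventually_right_inverse⟩

/-! ### Action of a point transformation on graphs, and quadratic test functions. -/

section Transformation

variable {D : Set Total} {φ : Total → Total} {u v : Base → ℝ} {z : Base}

lemma IsPointTransformation.contDiffAt (hφ : IsPointTransformation D φ) (hD : IsOpen D)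
    {p : Total} (hp : p ∈ D) : ContDiffAt ℝ ∞ φ p := hφ.smooth.contDiffAt (hD.mem_nhds hp)

/-- When `(P, Q)` restricted to the graph is a local diffeomorphism with inverse `σ`, the image of
the graph is again a graph: that of `R` along `σ`. -/
lemma exists_mapsGraph (hD : IsOpen D) (hφ : IsPointTransformation D φ) (hu : ContDiffAt ℝ ∞ u z)
    (hz : graphPt u z ∈ D)
    (hJ : pd et (fun w => (φ (graphPt u w)).1) z * pd ex (fun w => (φ (graphPt u w)).2.1) z
      - pd ex (fun w => (φ (graphPt u w)).1) z * pd et (fun w => (φ (graphPt u w)).2.1) z ≠ 0) :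
    ∃ v, MapsGraph D φ u v z := by
  have h0 : ContDiffAt ℝ ∞ (fun w => φ (graphPt u w)) z :=
    (hφ.contDiffAt hD hz).comp z (contDiffAt_graphPt hu)
  obtain ⟨σ, hσ, hσz, hl, -⟩ := exists_local_inverse h0.fst h0.snd.fst hJ
  refine ⟨fun y => (φ (graphPt u (σ y))).2.2, hz, hu, ?_, ?_⟩
  · have h1 : ContDiffAt ℝ ∞ (fun w => (φ (graphPt u w)).2.2) (σ (base (φ (graphPt u z)))) := by
      rw [base, hσz]; exact h0.snd.snd
    exact h1.comp _ hσ
  · filter_upwards [hl] with w hw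
    simp only [graphPt, base] at hw ⊢
    rw [hw]

/-- The quadratic function of `(t, x)` with prescribed derivatives at `z`. -/
noncomputable def quad (z : Base) (m a b c k : ℝ) (w : Base) : ℝ :=
  m + a * (w.1 - z.1) + b * (w.2 - z.2) + c / 2 * (w.2 - z.2) ^ 2 + k / 2 * (w.1 - z.1) ^ 2

variable (m a b c k : ℝ)

lemma contDiff_quad {n : WithTop ℕ∞} : ContDiff ℝ n (quad z m a b c k) := by
  unfold quad
  fun_prop

@[simp] lemma quad_self : quad z m a b c k z = m := by simp [quad]

@[simp] lemma graphPt_quad : graphPt (quad z m a b c k) z = (z.1, z.2, m) := by simp [graphPt]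

lemma pd_quad (e w : Base) : pd e (quad z m a b c k) w =
    e.1 * (a + k * (w.1 - z.1)) + e.2 * (b + c * (w.2 - z.2)) := by
  have h1 : HasFDerivAt (fun w : Base => w.1 - z.1) (ContinuousLinearMap.fst ℝ ℝ ℝ) w :=
    hasFDerivAt_fst.sub_const _
  have h2 : HasFDerivAt (fun w : Base => w.2 - z.2) (ContinuousLinearMap.snd ℝ ℝ ℝ) w :=
    hasFDerivAt_snd.sub_const _
  have h := ((((h1.const_mul a).const_add m).add (h2.const_mul b)).add
    ((h2.pow 2).const_mul (c / 2))).add ((h1.pow 2).const_mul (k / 2))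
  have h' : HasFDerivAt (quad z m a b c k) _ w := h
  rw [pd, h'.fderiv]
  simp
  ring

lemma pd_pd_quad (e e' w : Base) :
    pd e' (pd e (quad z m a b c k)) w = e.1 * e'.1 * k + e.2 * e'.2 * c := by
  have h : pd e (quad z m a b c k) =
      quad z (e.1 * a + e.2 * b) (e.1 * k) (e.2 * c) 0 0 := by
    ext w
    rw [pd_quad, quad]
    ring
  rw [h, pd_quad]
  ring

variable {m a b c k}

/-- Components of the transformation are smooth at points of the domain. -/
lemma IsPointTransformation.contDiffAt_fst (hφ : IsPointTransformation D φ) (hD : IsOpen D)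
    {p : Total} (hp : p ∈ D) : ContDiffAt ℝ ∞ (fun q => (φ q).1) p := (hφ.contDiffAt hD hp).fst

lemma IsPointTransformation.contDiffAt_snd_fst (hφ : IsPointTransformation D φ) (hD : IsOpen D)
    {p : Total} (hp : p ∈ D) : ContDiffAt ℝ ∞ (fun q => (φ q).2.1) p :=
  (hφ.contDiffAt hD hp).snd.fst

lemma IsPointTransformation.contDiffAt_snd_snd (hφ : IsPointTransformation D φ) (hD : IsOpen D)
    {p : Total} (hp : p ∈ D) : ContDiffAt ℝ ∞ (fun q => (φ q).2.2) p :=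
  (hφ.contDiffAt hD hp).snd.snd

/-- The Jacobian matrix of a point transformation has full rank. -/
lemma IsPointTransformation.exists_direction (hφ : IsPointTransformation D φ) (hD : IsOpen D)
    {p : Total} (hp : p ∈ D) (y : Total) :
    ∃ e : Total, pd e (fun q => (φ q).1) p = y.1 ∧ pd e (fun q => (φ q).2.1) p = y.2.1 ∧
      pd e (fun q => (φ q).2.2) p = y.2.2 := by
  have hs : Function.Surjective (fderiv ℝ φ p) := by
    have hu : IsUnit (LinearMap.det (fderiv ℝ φ p : Total →ₗ[ℝ] Total)) :=
      isUnit_iff_ne_zero.2 (hφ.jacobian p hp)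
    exact ((Module.End.isUnit_iff _).1 ((LinearMap.isUnit_iff_isUnit_det _).2 hu)).2
  have hd : HasFDerivAt φ _ p := ((hφ.contDiffAt hD hp).differentiableAt (by simp)).hasFDerivAt
  obtain ⟨e, rfl⟩ := hs y
  refine ⟨e, ?_, ?_, ?_⟩
  · rw [pd, hd.fst.fderiv]; rfl
  · rw [pd, hd.snd.fst.fderiv]; rfl
  · rw [pd, hd.snd.snd.fderiv]; rfl

lemma pd_total (e : Total) (F : Total → ℝ) (p : Total) :
    pd e F p = e.1 * pd Et F p + e.2.1 * pd Ex F p + e.2.2 * pd Eu F p :=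
  clm_total _ e

/-- Only the last component of the graph identity has content; the first two hold by definition of
`base`. -/
lemma MapsGraph.eventually_eq_comp (h : MapsGraph D φ u v z) :
    (fun w => (φ (graphPt u w)).2.2) =ᶠ[𝓝 z]
      fun w => v ((φ (graphPt u w)).1, (φ (graphPt u w)).2.1) := by
  filter_upwards [h.graph] with w hw
  exact congrArg (fun q : Total => q.2.2) hw

lemma MapsGraph.value (h : MapsGraph D φ u v z) :
    v (base (φ (graphPt u z))) = (φ (graphPt u z)).2.2 :=
  h.eventually_eq_comp.self_of_nhds.symm

/-- First-order consequences of `φ` mapping one graph to another. -/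
lemma MapsGraph.first_order (hD : IsOpen D) (hφ : IsPointTransformation D φ)
    (h : MapsGraph D φ u v z) (e : Base) :
    pd e (fun w => (φ (graphPt u w)).2.2) z =
      pd et v (base (φ (graphPt u z))) * pd e (fun w => (φ (graphPt u w)).1) z
      + pd ex v (base (φ (graphPt u z))) * pd e (fun w => (φ (graphPt u w)).2.1) z := by
  have h0 : ContDiffAt ℝ ∞ (fun w => φ (graphPt u w)) z :=
    (hφ.contDiffAt hD h.mem).comp z (contDiffAt_graphPt h.smooth_source)
  rw [pd_congr h.eventually_eq_comp]
  exact pd_comp_pair (f := fun w => (φ (graphPt u w)).1) (g := fun w => (φ (graphPt u w)).2.1)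
    (h.smooth_target.differentiableAt (by simp)) (h0.fst.differentiableAt (by simp))
    (h0.snd.fst.differentiableAt (by simp))

/-- The covector `dR - v_t dP - v_x dQ` at a point of the graph, where `φ = (P, Q, R)`, does not
vanish on the vertical direction. -/
lemma MapsGraph.vertical_ne_zero (hD : IsOpen D) (hφ : IsPointTransformation D φ)
    (h : MapsGraph D φ u v z) :
    pd Eu (fun q => (φ q).2.2) (graphPt u z)
      - pd et v (base (φ (graphPt u z))) * pd Eu (fun q => (φ q).1) (graphPt u z)
      - pd ex v (base (φ (graphPt u z))) * pd Eu (fun q => (φ q).2.1) (graphPt u z) ≠ 0 := by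
  intro hK
  have hP := (hφ.contDiffAt_fst hD h.mem).differentiableAt (by simp)
  have hQ := (hφ.contDiffAt_snd_fst hD h.mem).differentiableAt (by simp)
  have hR := (hφ.contDiffAt_snd_snd hD h.mem).differentiableAt (by simp)
  have hu := h.smooth_source.differentiableAt (by simp)
  have h1 := h.first_order hD hφ et
  have h2 := h.first_order hD hφ ex
  rw [pd_comp_graphPt hR hu, pd_comp_graphPt hP hu, pd_comp_graphPt hQ hu] at h1 h2
  simp only [one_mul, zero_mul, add_zero, zero_add] at h1 h2
  -- By `h1` and `h2` the covector kills the tangent plane of the graph. If it also killed the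
  -- vertical it would be zero, yet it takes the value 1 on `e`.
  obtain ⟨e, e1, e2, e3⟩ := hφ.exists_direction hD h.mem (0, 0, 1)
  rw [pd_total] at e1 e2 e3
  simp only at e1 e2 e3
  have : (0 : ℝ) = 1 := by
    linear_combination e3 - pd et v (base (φ (graphPt u z))) * e1
      - pd ex v (base (φ (graphPt u z))) * e2 - e.1 * h1 - e.2.1 * h2
      - (e.2.2 - e.1 * pd et u z - e.2.1 * pd ex u z) * hK
  exact zero_ne_one this

end Transformation

section

variable {D : Set Total} {φ : Total → Total} {θ θ' : Coeffs}

/-! ### Jets of the quadratic test functions and of their images. -/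

section Jets

variable {u v : Base → ℝ} {z : Base} {m a b c k : ℝ}

/-- Second-order consequences of `φ` mapping one graph to another. -/
lemma MapsGraph.second_order (hD : IsOpen D) (hφ : IsPointTransformation D φ)
    (h : MapsGraph D φ u v z) (e e' : Base) :
    ∀ y, y = base (φ (graphPt u z)) →
    pd e' (pd e (fun w => (φ (graphPt u w)).2.2)) z =
      (pd et (pd et v) y * pd e' (fun w => (φ (graphPt u w)).1) z
        + pd ex (pd et v) y * pd e' (fun w => (φ (graphPt u w)).2.1) z)
          * pd e (fun w => (φ (graphPt u w)).1) z
      + pd et v y * pd e' (pd e (fun w => (φ (graphPt u w)).1)) z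
      + (pd et (pd ex v) y * pd e' (fun w => (φ (graphPt u w)).1) z
        + pd ex (pd ex v) y * pd e' (fun w => (φ (graphPt u w)).2.1) z)
          * pd e (fun w => (φ (graphPt u w)).2.1) z
      + pd ex v y * pd e' (pd e (fun w => (φ (graphPt u w)).2.1)) z := by
  rintro y rfl
  have h0 : ContDiffAt ℝ 2 (fun w => φ (graphPt u w)) z :=
    ((hφ.contDiffAt hD h.mem).comp z (contDiffAt_graphPt h.smooth_source)).of_le
      (WithTop.coe_le_coe.2 le_top)
  exact pd_pd_comp_pair (f := fun w => (φ (graphPt u w)).1)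
    (g := fun w => (φ (graphPt u w)).2.1)
    (h.smooth_target.of_le (WithTop.coe_le_coe.2 le_top)) h0.fst h0.snd.fst h.eventually_eq_comp

variable {F : Total → ℝ}

lemma pd_et_comp_quad (hF : ContDiffAt ℝ ∞ F (z.1, z.2, m)) :
    pd et (fun w => F (graphPt (quad z m a b c k) w)) z =
      pd Et F (z.1, z.2, m) + a * pd Eu F (z.1, z.2, m) := by
  rw [← graphPt_quad m a b c k] at hF
  rw [pd_comp_graphPt (hF.differentiableAt (by simp))
    ((contDiff_quad m a b c k).differentiable one_ne_zero z), pd_quad]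
  simp

lemma pd_ex_comp_quad (hF : ContDiffAt ℝ ∞ F (z.1, z.2, m)) :
    pd ex (fun w => F (graphPt (quad z m a b c k) w)) z =
      pd Ex F (z.1, z.2, m) + b * pd Eu F (z.1, z.2, m) := by
  rw [← graphPt_quad m a b c k] at hF
  rw [pd_comp_graphPt (hF.differentiableAt (by simp))
    ((contDiff_quad m a b c k).differentiable one_ne_zero z), pd_quad]
  simp

/-- Total second derivatives are affine in the second derivatives of `u`, with slope `F_u`. The
constant term `r` cancels in differences, so it need not be explicit. -/
lemma pd_pd_comp_quad (hF : ContDiffAt ℝ ∞ F (z.1, z.2, m)) (e e' : Base) :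
    ∃ r, ∀ c k, pd e' (pd e (fun w => F (graphPt (quad z m a b c k) w))) z =
      r + (e.1 * e'.1 * k + e.2 * e'.2 * c) * pd Eu F (z.1, z.2, m) := by
  have hF' : ∀ c k, ContDiffAt ℝ 2 F (graphPt (quad z m a b c k) z) := fun c k => by
    rw [graphPt_quad]; exact hF.of_le (WithTop.coe_le_coe.2 le_top)
  refine ⟨pd e' (pd e (fun w => F (graphPt (quad z m a b 0 0) w))) z, fun c k => ?_⟩
  simp only [pd_pd_comp_graphPt (hF' _ _) (contDiff_quad ..).contDiffAt, pd_pd_quad, pd_quad,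
    graphPt_quad, sub_self, mul_zero, add_zero]
  ring

/-- Explicit, unlike `pd_pd_comp_quad`, because the dependence on `b = u_x` is what
`Connects.affine_in_u` exploits. -/
lemma pd_ex_ex_comp_quad (hF : ContDiffAt ℝ ∞ F (z.1, z.2, m)) :
    pd ex (pd ex (fun w => F (graphPt (quad z m a b c k) w))) z =
      pd Ex (pd Ex F) (z.1, z.2, m) + b * (2 * pd Ex (pd Eu F) (z.1, z.2, m))
        + b ^ 2 * pd Eu (pd Eu F) (z.1, z.2, m) + c * pd Eu F (z.1, z.2, m) := by
  have hF' := hF.of_le (n := ∞) (m := 2) (WithTop.coe_le_coe.2 le_top)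
  have hs := pd_pd_comm Ex Eu hF'
  rw [← graphPt_quad m a b c k] at hF'
  rw [pd_pd_comp_graphPt hF' (contDiff_quad ..).contDiffAt,
    pd_pd_quad, pd_quad, graphPt_quad]
  simp only [sub_self, mul_zero, add_zero, ← hs]
  ring

lemma exists_mapsGraph_quad (hD : IsOpen D) (hφ : IsPointTransformation D φ)
    (hp : (z.1, z.2, m) ∈ D)
    (hJ : (pd Et (fun q => (φ q).1) (z.1, z.2, m) + a * pd Eu (fun q => (φ q).1) (z.1, z.2, m))
        * (pd Ex (fun q => (φ q).2.1) (z.1, z.2, m)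
          + b * pd Eu (fun q => (φ q).2.1) (z.1, z.2, m))
      - (pd Ex (fun q => (φ q).1) (z.1, z.2, m) + b * pd Eu (fun q => (φ q).1) (z.1, z.2, m))
        * (pd Et (fun q => (φ q).2.1) (z.1, z.2, m)
          + a * pd Eu (fun q => (φ q).2.1) (z.1, z.2, m)) ≠ 0) :
    ∃ v, MapsGraph D φ (quad z m a b c k) v z := by
  refine exists_mapsGraph hD hφ (contDiff_quad ..).contDiffAt (by simpa using hp) ?_
  rwa [pd_et_comp_quad (hφ.contDiffAt_fst hD hp), pd_ex_comp_quad (hφ.contDiffAt_fst hD hp),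
    pd_et_comp_quad (hφ.contDiffAt_snd_fst hD hp), pd_ex_comp_quad (hφ.contDiffAt_snd_fst hD hp)]

lemma satisfiedAt_quad : θ.SatisfiedAt (quad z m a b c k) z ↔ a + θ.C z * m * b = θ.A2 z * c := by
  rw [Coeffs.satisfiedAt_iff (contDiff_quad ..).contDiffAt, pd_quad, pd_quad, pd_pd_quad]
  simp

lemma MapsGraph.satisfiedAt_iff (h : MapsGraph D φ u v z) :
    ∀ y, y = base (φ (graphPt u z)) →
    (θ'.SatisfiedAt v y ↔
      pd et v y + θ'.C y * (φ (graphPt u z)).2.2 * pd ex v y = θ'.A2 y * pd ex (pd ex v) y) := by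
  rintro y rfl
  rw [Coeffs.satisfiedAt_iff (h.smooth_target.of_le (WithTop.coe_le_coe.2 le_top)), h.value]

end Jets

/-! ### The new time depends on the old time only. -/

lemma Coeffs.InClass.A2_ne_zero {Ω : Set Base} (h : θ.InClass Ω) {z : Base} (hz : z ∈ Ω) :
    θ.A2 z ≠ 0 := left_ne_zero_of_mul (h.ne_zero z hz)

lemma Coeffs.InClass.C_ne_zero {Ω : Set Base} (h : θ.InClass Ω) {z : Base} (hz : z ∈ Ω) :
    θ.C z ≠ 0 := right_ne_zero_of_mul (h.ne_zero z hz)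

/-- Varying `u_tt` with the other jet coordinates fixed. -/
lemma Connects.total_dx_time_eq_zero (hD : IsOpen D) (hφ : IsPointTransformation D φ)
    (hθ : θ.InClass (base '' D)) (hθ' : θ'.InClass (base '' (φ '' D))) (h : Connects D φ θ θ')
    {z : Base} {m a b : ℝ} (hp : (z.1, z.2, m) ∈ D)
    (hJ : (pd Et (fun q => (φ q).1) (z.1, z.2, m) + a * pd Eu (fun q => (φ q).1) (z.1, z.2, m))
        * (pd Ex (fun q => (φ q).2.1) (z.1, z.2, m)
          + b * pd Eu (fun q => (φ q).2.1) (z.1, z.2, m))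
      - (pd Ex (fun q => (φ q).1) (z.1, z.2, m) + b * pd Eu (fun q => (φ q).1) (z.1, z.2, m))
        * (pd Et (fun q => (φ q).2.1) (z.1, z.2, m)
          + a * pd Eu (fun q => (φ q).2.1) (z.1, z.2, m)) ≠ 0) :
    pd Ex (fun q => (φ q).1) (z.1, z.2, m)
      + b * pd Eu (fun q => (φ q).1) (z.1, z.2, m) = 0 := by
  have hP := hφ.contDiffAt_fst hD hp
  have hQ := hφ.contDiffAt_snd_fst hD hp
  have hR := hφ.contDiffAt_snd_snd hD hp
  have hA := hθ.A2_ne_zero (mem_image_of_mem base hp)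
  have hA' := hθ'.A2_ne_zero (mem_image_of_mem base (mem_image_of_mem φ hp))
  -- This value of `u_xx` solves the source equation whatever `k = u_tt` is.
  set c : ℝ := (a + θ.C z * m * b) / θ.A2 z with hc
  have hsat : ∀ k, θ.SatisfiedAt (quad z m a b c k) z := fun k => by
    rw [satisfiedAt_quad, hc]
    exact (mul_div_cancel₀ _ hA).symm
  obtain ⟨v, hv⟩ := exists_mapsGraph_quad (c := c) (k := 0) hD hφ hp hJ
  obtain ⟨w, hw⟩ := exists_mapsGraph_quad (c := c) (k := 1) hD hφ hp hJ
  have sv := (h _ _ _ hv).1 (hsat 0)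
  have sw := (h _ _ _ hw).1 (hsat 1)
  -- The image point depends only on `(t, x, u)`, so both test functions are compared at a common
  -- target point.
  have ey : ∀ k, base (φ (z.1, z.2, m)) = base (φ (graphPt (quad z m a b c k) z)) :=
    fun k => by rw [graphPt_quad]
  have kv := hv.vertical_ne_zero hD hφ
  have v1 := hv.first_order hD hφ et
  have v2 := hv.first_order hD hφ ex
  have w1 := hw.first_order hD hφ et
  have w2 := hw.first_order hD hφ ex
  have v11 := hv.second_order hD hφ et et _ (ey 0)
  have v12 := hv.second_order hD hφ et ex _ (ey 0)
  have v22 := hv.second_order hD hφ ex ex _ (ey 0)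
  have w11 := hw.second_order hD hφ et et _ (ey 1)
  have w12 := hw.second_order hD hφ et ex _ (ey 1)
  have w22 := hw.second_order hD hφ ex ex _ (ey 1)
  have cv : ContDiffAt ℝ 2 v (base (φ (z.1, z.2, m))) := by
    rw [ey 0]; exact hv.smooth_target.of_le (WithTop.coe_le_coe.2 le_top)
  have cw : ContDiffAt ℝ 2 w (base (φ (z.1, z.2, m))) := by
    rw [ey 1]; exact hw.smooth_target.of_le (WithTop.coe_le_coe.2 le_top)
  rw [pd_pd_comm ex et cv] at v12 v11 v22
  rw [pd_pd_comm ex et cw] at w12 w11 w22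
  rw [hv.satisfiedAt_iff _ rfl] at sv
  rw [hw.satisfiedAt_iff _ rfl] at sw
  obtain ⟨p11, hp11⟩ := pd_pd_comp_quad (a := a) (b := b) hP et et
  obtain ⟨p12, hp12⟩ := pd_pd_comp_quad (a := a) (b := b) hP et ex
  obtain ⟨p22, hp22⟩ := pd_pd_comp_quad (a := a) (b := b) hP ex ex
  obtain ⟨q11, hq11⟩ := pd_pd_comp_quad (a := a) (b := b) hQ et et
  obtain ⟨q12, hq12⟩ := pd_pd_comp_quad (a := a) (b := b) hQ et ex
  obtain ⟨q22, hq22⟩ := pd_pd_comp_quad (a := a) (b := b) hQ ex ex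
  obtain ⟨r11, hr11⟩ := pd_pd_comp_quad (a := a) (b := b) hR et et
  obtain ⟨r12, hr12⟩ := pd_pd_comp_quad (a := a) (b := b) hR et ex
  obtain ⟨r22, hr22⟩ := pd_pd_comp_quad (a := a) (b := b) hR ex ex
  rw [hp11, hq11, hr11] at v11 w11
  rw [hp12, hq12, hr12] at v12 w12
  rw [hp22, hq22, hr22] at v22 w22
  simp only [pd_et_comp_quad hP, pd_ex_comp_quad hP, pd_et_comp_quad hQ, pd_ex_comp_quad hQ,
    pd_et_comp_quad hR, pd_ex_comp_quad hR, graphPt_quad] at *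
  simp only [mul_one, mul_zero, zero_mul, one_mul, add_zero, zero_add] at v11 v12 v22 w11 w12 w22
  generalize base (φ (z.1, z.2, m)) = y at *
  generalize pd Et (fun q => (φ q).1) (z.1, z.2, m) = Pt at *
  generalize pd Ex (fun q => (φ q).1) (z.1, z.2, m) = Px at *
  generalize pd Eu (fun q => (φ q).1) (z.1, z.2, m) = Pu at *
  generalize pd Et (fun q => (φ q).2.1) (z.1, z.2, m) = Qt at *
  generalize pd Ex (fun q => (φ q).2.1) (z.1, z.2, m) = Qx at *
  generalize pd Eu (fun q => (φ q).2.1) (z.1, z.2, m) = Qu at *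
  generalize pd Et (fun q => (φ q).2.2) (z.1, z.2, m) = Rt at *
  generalize pd Ex (fun q => (φ q).2.2) (z.1, z.2, m) = Rx at *
  generalize pd Eu (fun q => (φ q).2.2) (z.1, z.2, m) = Ru at *
  -- Cramer's rule: the first-order relations are the same linear system for `v` and `w`, with
  -- determinant the total Jacobian.
  have et' : pd et w y = pd et v y := by
    refine sub_eq_zero.1 ((mul_eq_zero.1 ?_).resolve_right hJ)
    linear_combination (Qx + b * Qu) * (v1 - w1) - (Qt + a * Qu) * (v2 - w2)
  have ex' : pd ex w y = pd ex v y := by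
    refine sub_eq_zero.1 ((mul_eq_zero.1 ?_).resolve_right hJ)
    linear_combination (Pt + a * Pu) * (v2 - w2) - (Px + b * Pu) * (v1 - w1)
  rw [et', ex'] at sw w11 w12 w22
  -- Given the first derivatives, the target equation determines `v_xx`.
  have exx : pd ex (pd ex w) y = pd ex (pd ex v) y := mul_left_cancel₀ hA' (by rw [← sv, ← sw])
  rw [exx] at w11 w12 w22
  -- Evaluate the second-order relations on the direction `(D_x P, -D_t P)`, which the total
  -- differential of `P` kills: `v_tt` and `v_tx` drop out, the `v_xx` terms agree, and only the
  -- change of `u_tt` remains.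
  have : (Ru - pd et v y * Pu - pd ex v y * Qu) * (Px + b * Pu) ^ 2 = 0 := by
    linear_combination (Px + b * Pu) ^ 2 * (w11 - v11)
      - 2 * (Px + b * Pu) * (Pt + a * Pu) * (w12 - v12) + (Pt + a * Pu) ^ 2 * (w22 - v22)
  exact pow_eq_zero_iff two_ne_zero |>.1 ((mul_eq_zero.1 this).resolve_left kv)

/-- `D_x P` times the total Jacobian is a polynomial in `(u_t, u_x)` that vanishes identically. Its
coefficients are combinations of `P_x`, `P_u` with the 2×2 minors of `(dP, dQ)`, and those minors
are not all zero. -/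
lemma Connects.time_only (hD : IsOpen D) (hφ : IsPointTransformation D φ)
    (hθ : θ.InClass (base '' D)) (hθ' : θ'.InClass (base '' (φ '' D))) (h : Connects D φ θ θ')
    {p : Total} (hp : p ∈ D) :
    pd Ex (fun q => (φ q).1) p = 0 ∧ pd Eu (fun q => (φ q).1) p = 0 := by
  have key := fun a b => h.total_dx_time_eq_zero (z := base p) (m := p.2.2) (a := a) (b := b)
    hD hφ hθ hθ' hp
  obtain ⟨e, e1, e2, -⟩ := hφ.exists_direction hD hp (1, 0, 0)
  obtain ⟨f, f1, f2, -⟩ := hφ.exists_direction hD hp (0, 1, 0)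
  rw [pd_total] at e1 e2 f1 f2
  change ∀ a b : ℝ, (pd Et (fun q => (φ q).1) p + a * pd Eu (fun q => (φ q).1) p)
        * (pd Ex (fun q => (φ q).2.1) p + b * pd Eu (fun q => (φ q).2.1) p)
      - (pd Ex (fun q => (φ q).1) p + b * pd Eu (fun q => (φ q).1) p)
        * (pd Et (fun q => (φ q).2.1) p + a * pd Eu (fun q => (φ q).2.1) p) ≠ 0 →
      pd Ex (fun q => (φ q).1) p + b * pd Eu (fun q => (φ q).1) p = 0 at key
  generalize pd Et (fun q => (φ q).1) p = Pt at *
  generalize pd Ex (fun q => (φ q).1) p = Px at *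
  generalize pd Eu (fun q => (φ q).1) p = Pu at *
  generalize pd Et (fun q => (φ q).2.1) p = Qt at *
  generalize pd Ex (fun q => (φ q).2.1) p = Qx at *
  generalize pd Eu (fun q => (φ q).2.1) p = Qu at *
  -- Where the Jacobian vanishes the product is trivially zero, so the identity holds for all `a`
  -- and `b`.
  have hmul : ∀ a b : ℝ, (Px + b * Pu)
      * ((Pt + a * Pu) * (Qx + b * Qu) - (Px + b * Pu) * (Qt + a * Qu)) = 0 := by
    intro a b
    by_contra hne
    exact hne (by rw [key a b (right_ne_zero_of_mul hne), zero_mul])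
  -- Cauchy–Binet for `(dP, dQ)` applied to `e` and `f`.
  have hminor : (Pt * Qx - Px * Qt) * (e.1 * f.2.1 - e.2.1 * f.1)
      + (Px * Qu - Pu * Qx) * (e.2.1 * f.2.2 - e.2.2 * f.2.1)
      + (Pt * Qu - Pu * Qt) * (e.1 * f.2.2 - e.2.2 * f.1) = 1 := by
    simp only at e1 e2 f1 f2
    linear_combination (Qt * f.1 + Qx * f.2.1 + Qu * f.2.2) * e1 + f2
      - (Pt * f.1 + Px * f.2.1 + Pu * f.2.2) * e2
  have hx : Px * (Pt * Qx - Px * Qt) = 0 := by linear_combination hmul 0 0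
  have hx1 : Px * (Px * Qu - Pu * Qx) = 0 := by linear_combination hmul 0 0 - hmul 1 0
  have hu1 : Pu * (Px * Qu - Pu * Qx) = 0 := by
    linear_combination hmul 0 1 - hmul 1 1 + hmul 1 0 - hmul 0 0
  have hu : Pu * (Pt * Qu - Pu * Qt) = 0 := by
    linear_combination (hmul 0 1 + hmul 0 (-1)) / 2 - hmul 0 0
  have hxu : Px * (Pt * Qu - Pu * Qt) + Pu * (Pt * Qx - Px * Qt) = 0 := by
    linear_combination (hmul 0 1 - hmul 0 (-1)) / 2
  by_cases c1 : Px * Qu - Pu * Qx = 0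
  · by_cases c0 : Pt * Qx - Px * Qt = 0
    · have c2 : Pt * Qu - Pu * Qt ≠ 0 := by
        intro c2
        rw [c0, c1, c2] at hminor
        simp at hminor
      have hPu := (mul_eq_zero.1 hu).resolve_right c2
      exact ⟨(mul_eq_zero.1 (by linear_combination hxu - (Pt * Qx - Px * Qt) * hPu :
        Px * (Pt * Qu - Pu * Qt) = 0)).resolve_right c2, hPu⟩
    · have hPx := (mul_eq_zero.1 hx).resolve_right c0
      exact ⟨hPx, (mul_eq_zero.1 (by linear_combination hxu - (Pt * Qu - Pu * Qt) * hPx :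
        Pu * (Pt * Qx - Px * Qt) = 0)).resolve_right c0⟩
  · exact ⟨(mul_eq_zero.1 hx1).resolve_right c1, (mul_eq_zero.1 hu1).resolve_right c1⟩

end

/-! ### The new space variable is independent of `u`, and the new unknown is affine in `u`. -/

section

variable {D : Set Total} {φ : Total → Total} {θ θ' : Coeffs}

lemma pd_eq_zero_of_forall {E : Type*} [NormedAddCommGroup E] [NormedSpace ℝ E] {S : Set E}
    (hS : IsOpen S) {e : E} {F : E → ℝ} (h : ∀ p ∈ S, F p = 0) {p : E} (hp : p ∈ S) :
    pd e F p = 0 := by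
  have h0 : F =ᶠ[𝓝 p] fun _ => 0 := by
    filter_upwards [hS.mem_nhds hp] with q hq using h q hq
  rw [pd_congr h0]
  simp [pd]

/-- Varying `u_t` and `u_xx` along the equation with the other jet coordinates fixed. -/
lemma Connects.A2_relation (hD : IsOpen D) (hφ : IsPointTransformation D φ) (h : Connects D φ θ θ')
    (hPx : ∀ p ∈ D, pd Ex (fun q => (φ q).1) p = 0)
    (hPu : ∀ p ∈ D, pd Eu (fun q => (φ q).1) p = 0)
    {z : Base} {m b : ℝ} (hp : (z.1, z.2, m) ∈ D)
    (hPt : pd Et (fun q => (φ q).1) (z.1, z.2, m) ≠ 0)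
    (hQ0 : pd Ex (fun q => (φ q).2.1) (z.1, z.2, m)
      + b * pd Eu (fun q => (φ q).2.1) (z.1, z.2, m) ≠ 0) :
    θ'.A2 (base (φ (z.1, z.2, m))) * pd Et (fun q => (φ q).1) (z.1, z.2, m) =
      θ.A2 z * (pd Ex (fun q => (φ q).2.1) (z.1, z.2, m)
        + b * pd Eu (fun q => (φ q).2.1) (z.1, z.2, m)) ^ 2 := by
  have hP := hφ.contDiffAt_fst hD hp
  have hQ := hφ.contDiffAt_snd_fst hD hp
  have hR := hφ.contDiffAt_snd_snd hD hp
  have px := hPx _ hp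
  have pu := hPu _ hp
  have pxx := pd_eq_zero_of_forall hD (e := Ex) hPx hp
  have pxu := pd_eq_zero_of_forall hD (e := Ex) hPu hp
  have puu := pd_eq_zero_of_forall hD (e := Eu) hPu hp
  have hJ : ∀ a : ℝ,
      (pd Et (fun q => (φ q).1) (z.1, z.2, m) + a * pd Eu (fun q => (φ q).1) (z.1, z.2, m))
        * (pd Ex (fun q => (φ q).2.1) (z.1, z.2, m)
          + b * pd Eu (fun q => (φ q).2.1) (z.1, z.2, m))
      - (pd Ex (fun q => (φ q).1) (z.1, z.2, m) + b * pd Eu (fun q => (φ q).1) (z.1, z.2, m))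
        * (pd Et (fun q => (φ q).2.1) (z.1, z.2, m)
          + a * pd Eu (fun q => (φ q).2.1) (z.1, z.2, m)) ≠ 0 := by
    intro a
    rw [px, pu]
    simpa using And.intro hPt hQ0
  -- Two solutions of the source equation at the point with the same `u_x`: raising `u_xx` by 1
  -- raises `u_t` by `A²`.
  obtain ⟨v, hv⟩ := exists_mapsGraph_quad (c := 0) (k := 0) hD hφ hp (hJ (-(θ.C z * m * b)))
  obtain ⟨w, hw⟩ := exists_mapsGraph_quad (c := 1) (k := 0) hD hφ hp
    (hJ (θ.A2 z - θ.C z * m * b))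
  have sv := (h _ _ _ hv).1 (satisfiedAt_quad.2 (by ring))
  have sw := (h _ _ _ hw).1 (satisfiedAt_quad.2 (by ring))
  rw [hv.satisfiedAt_iff _ rfl] at sv
  rw [hw.satisfiedAt_iff _ rfl] at sw
  have kv := hv.vertical_ne_zero hD hφ
  have v1 := hv.first_order hD hφ et
  have v2 := hv.first_order hD hφ ex
  have w1 := hw.first_order hD hφ et
  have w2 := hw.first_order hD hφ ex
  have v22 := hv.second_order hD hφ ex ex _ rfl
  have w22 := hw.second_order hD hφ ex ex _ rfl
  simp only [pd_et_comp_quad hP, pd_ex_comp_quad hP, pd_et_comp_quad hQ, pd_ex_comp_quad hQ,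
    pd_et_comp_quad hR, pd_ex_comp_quad hR, pd_ex_ex_comp_quad hP, pd_ex_ex_comp_quad hQ,
    pd_ex_ex_comp_quad hR, graphPt_quad, px, pu, pxx, pxu, puu, mul_zero, add_zero, zero_add,
    zero_mul, sub_zero, one_mul] at kv v1 v2 w1 w2 v22 w22 sv sw
  generalize base (φ (z.1, z.2, m)) = y at *
  generalize pd Et (fun q => (φ q).1) (z.1, z.2, m) = Pt at *
  generalize pd Et (fun q => (φ q).2.1) (z.1, z.2, m) = Qt at *
  generalize pd Ex (fun q => (φ q).2.1) (z.1, z.2, m) = Qx at *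
  generalize pd Eu (fun q => (φ q).2.1) (z.1, z.2, m) = Qu at *
  generalize pd Et (fun q => (φ q).2.2) (z.1, z.2, m) = Rt at *
  generalize pd Ex (fun q => (φ q).2.2) (z.1, z.2, m) = Rx at *
  generalize pd Eu (fun q => (φ q).2.2) (z.1, z.2, m) = Ru at *
  have ex' : pd ex w y = pd ex v y := mul_right_cancel₀ hQ0 (by rw [← v2, ← w2])
  rw [ex'] at sw w1 w22
  refine mul_left_cancel₀ kv ?_
  linear_combination θ'.A2 y * Pt * (w22 - v22) + (Qx + b * Qu) ^ 2 * Pt * (sv - sw)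
    - (Qx + b * Qu) ^ 2 * (w1 - v1)

/-- If `Q_u ≠ 0`, varying `u_x` gives `D_x Q` any value; the values 1 and 2 in
`Connects.A2_relation` yield `A² = 4 A²`. -/
lemma Connects.space_projectable (hD : IsOpen D) (hφ : IsPointTransformation D φ)
    (hθ : θ.InClass (base '' D)) (h : Connects D φ θ θ')
    (hPx : ∀ p ∈ D, pd Ex (fun q => (φ q).1) p = 0)
    (hPu : ∀ p ∈ D, pd Eu (fun q => (φ q).1) p = 0) {p : Total} (hp : p ∈ D)
    (hPt : pd Et (fun q => (φ q).1) p ≠ 0) : pd Eu (fun q => (φ q).2.1) p = 0 := by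
  by_contra hQu
  have key := fun b => h.A2_relation (z := base p) (m := p.2.2) (b := b) hD hφ hPx hPu hp hPt
  change ∀ b : ℝ, pd Ex (fun q => (φ q).2.1) p + b * pd Eu (fun q => (φ q).2.1) p ≠ 0 →
    θ'.A2 (base (φ p)) * pd Et (fun q => (φ q).1) p = θ.A2 (base p)
      * (pd Ex (fun q => (φ q).2.1) p + b * pd Eu (fun q => (φ q).2.1) p) ^ 2 at key
  have hb : ∀ s : ℝ, pd Ex (fun q => (φ q).2.1) p
      + (s - pd Ex (fun q => (φ q).2.1) p) / pd Eu (fun q => (φ q).2.1) p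
        * pd Eu (fun q => (φ q).2.1) p = s := fun s => by
    rw [div_mul_cancel₀ _ hQu]; ring
  have k1 := key _ (by rw [hb 1]; exact one_ne_zero)
  have k2 := key _ (by rw [hb 2]; exact two_ne_zero)
  rw [hb] at k1 k2
  exact hθ.A2_ne_zero (mem_image_of_mem base hp) (by linarith)

/-- The second difference in `u_x` of the transformed equation. -/
lemma Connects.affine_in_u (hD : IsOpen D) (hφ : IsPointTransformation D φ)
    (hθ' : θ'.InClass (base '' (φ '' D))) (h : Connects D φ θ θ')
    (hPx : ∀ p ∈ D, pd Ex (fun q => (φ q).1) p = 0)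
    (hPu : ∀ p ∈ D, pd Eu (fun q => (φ q).1) p = 0)
    (hQu : ∀ p ∈ D, pd Eu (fun q => (φ q).2.1) p = 0)
    {z : Base} {m : ℝ} (hp : (z.1, z.2, m) ∈ D)
    (hPt : pd Et (fun q => (φ q).1) (z.1, z.2, m) ≠ 0)
    (hQx : pd Ex (fun q => (φ q).2.1) (z.1, z.2, m) ≠ 0) :
    pd Eu (pd Eu (fun q => (φ q).2.2)) (z.1, z.2, m) = 0 := by
  have hA' := hθ'.A2_ne_zero (mem_image_of_mem base (mem_image_of_mem φ hp))
  have hP := hφ.contDiffAt_fst hD hp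
  have hQ := hφ.contDiffAt_snd_fst hD hp
  have hR := hφ.contDiffAt_snd_snd hD hp
  have px := hPx _ hp
  have pu := hPu _ hp
  have pxx := pd_eq_zero_of_forall hD (e := Ex) hPx hp
  have pxu := pd_eq_zero_of_forall hD (e := Ex) hPu hp
  have puu := pd_eq_zero_of_forall hD (e := Eu) hPu hp
  have qu := hQu _ hp
  have qxu := pd_eq_zero_of_forall hD (e := Ex) hQu hp
  have quu := pd_eq_zero_of_forall hD (e := Eu) hQu hp
  -- With `u_xx = 0` the equation forces `u_t = -C u u_x`, linear in `b`. So `v_x`, `v_t` and, by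
  -- the target equation, `v_xx` are affine in `b`, and the only quadratic term is `b² R_uu`.
  have key : ∀ b : ℝ, ∃ vt vx vxx : ℝ,
      vt + θ'.C (base (φ (z.1, z.2, m))) * (φ (z.1, z.2, m)).2.2 * vx
        = θ'.A2 (base (φ (z.1, z.2, m))) * vxx ∧
      pd Et (fun q => (φ q).2.2) (z.1, z.2, m)
        - θ.C z * m * b * pd Eu (fun q => (φ q).2.2) (z.1, z.2, m)
        = vt * pd Et (fun q => (φ q).1) (z.1, z.2, m)
          + vx * pd Et (fun q => (φ q).2.1) (z.1, z.2, m) ∧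
      pd Ex (fun q => (φ q).2.2) (z.1, z.2, m)
        + b * pd Eu (fun q => (φ q).2.2) (z.1, z.2, m)
        = vx * pd Ex (fun q => (φ q).2.1) (z.1, z.2, m) ∧
      pd Ex (pd Ex (fun q => (φ q).2.2)) (z.1, z.2, m)
        + b * (2 * pd Ex (pd Eu (fun q => (φ q).2.2)) (z.1, z.2, m))
        + b ^ 2 * pd Eu (pd Eu (fun q => (φ q).2.2)) (z.1, z.2, m)
        = vxx * pd Ex (fun q => (φ q).2.1) (z.1, z.2, m) ^ 2
          + vx * pd Ex (pd Ex (fun q => (φ q).2.1)) (z.1, z.2, m) := by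
    intro b
    obtain ⟨v, hv⟩ := exists_mapsGraph_quad (a := -(θ.C z * m * b)) (b := b) (c := 0) (k := 0)
      hD hφ hp (by rw [px, pu, qu]; simpa using And.intro hPt hQx)
    have sv := (h _ _ _ hv).1 (satisfiedAt_quad.2 (by ring))
    rw [hv.satisfiedAt_iff _ rfl] at sv
    have v1 := hv.first_order hD hφ et
    have v2 := hv.first_order hD hφ ex
    have v22 := hv.second_order hD hφ ex ex _ rfl
    simp only [pd_et_comp_quad hP, pd_ex_comp_quad hP, pd_et_comp_quad hQ, pd_ex_comp_quad hQ,
      pd_et_comp_quad hR, pd_ex_comp_quad hR, pd_ex_ex_comp_quad hP, pd_ex_ex_comp_quad hQ,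
      pd_ex_ex_comp_quad hR, graphPt_quad, px, pu, pxx, pxu, puu, qu, qxu, quu, mul_zero, add_zero,
      zero_add, zero_mul] at v1 v2 v22 sv
    exact ⟨_, _, _, sv, by linear_combination v1, v2, by linear_combination v22⟩
  obtain ⟨v1, v2, v3, e1, e2, e3, e4⟩ := key 0
  obtain ⟨w1, w2, w3, f1, f2, f3, f4⟩ := key 1
  obtain ⟨y1, y2, y3, g1, g2, g3, g4⟩ := key (-1)
  have d2 : w2 + y2 - 2 * v2 = 0 := by
    refine (mul_eq_zero.1 ?_).resolve_right hQx
    linear_combination 2 * e3 - f3 - g3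
  have d1 : w1 + y1 - 2 * v1 = 0 := by
    refine (mul_eq_zero.1 ?_).resolve_right hPt
    linear_combination 2 * e2 - f2 - g2 - pd Et (fun q => (φ q).2.1) (z.1, z.2, m) * d2
  have d3 : w3 + y3 - 2 * v3 = 0 := by
    refine (mul_eq_zero.1 ?_).resolve_left hA'
    linear_combination 2 * e1 - f1 - g1 + d1
      + θ'.C (base (φ (z.1, z.2, m))) * (φ (z.1, z.2, m)).2.2 * d2
  linear_combination (f4 + g4 - 2 * e4
    + pd Ex (fun q => (φ q).2.1) (z.1, z.2, m) ^ 2 * d3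
    + pd Ex (pd Ex (fun q => (φ q).2.1)) (z.1, z.2, m) * d2) / 2

/-! ### From vanishing derivatives to functions of fewer variables. -/

section Descent

variable {F : Total → ℝ}

lemma isOpen_fst_image (hD : IsOpen D) : IsOpen (Prod.fst '' D) := isOpenMap_fst D hD

lemma isOpen_base_image (hD : IsOpen D) : IsOpen (base '' D) := by
  rw [isOpen_iff_mem_nhds]
  rintro _ ⟨p, hp, rfl⟩
  have hc : Tendsto (fun w : Base => (w.1, w.2, p.2.2)) (𝓝 (base p)) (𝓝 p) :=
    Continuous.tendsto' (by fun_prop) _ _ rfl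
  filter_upwards [hc.eventually (hD.mem_nhds hp)] with w hw
  exact ⟨_, hw, rfl⟩

/-- A smooth function with vanishing `u`-derivative is a smooth function of `(t, x)`. -/
lemma exists_base_of_pd_eq_zero (hD : IsFibredDomain D) (hF : ∀ p ∈ D, ContDiffAt ℝ ∞ F p)
    (hu : ∀ p ∈ D, pd Eu F p = 0) :
    ∃ f : Base → ℝ, ContDiffOn ℝ ∞ f (base '' D) ∧ ∀ p ∈ D, F p = f (base p) := by
  have hconst : ∀ t x u u' : ℝ, (t, x, u) ∈ D → (t, x, u') ∈ D → F (t, x, u) = F (t, x, u') := by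
    intro t x u u' h h'
    have ho : IsOpen {u : ℝ | (t, x, u) ∈ D} := hD.isOpen.preimage (by fun_prop)
    have hd : ∀ s : ℝ, (t, x, s) ∈ D → HasDerivAt (fun s => F (t, x, s)) 0 s := by
      intro s hs
      have h1 : HasDerivAt (fun s : ℝ => ((t, x, s) : Total)) (0, 0, 1) s :=
        (hasDerivAt_const s t).prodMk ((hasDerivAt_const s x).prodMk (hasDerivAt_id s))
      have h2 := HasFDerivAt.comp_hasDerivAt (f := fun s : ℝ => ((t, x, s) : Total)) s
        ((hF _ hs).differentiableAt (by simp)).hasFDerivAt h1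
      have h3 : fderiv ℝ F (t, x, s) (0, 0, 1) = 0 := hu _ hs
      rwa [h3] at h2
    exact ho.is_const_of_deriv_eq_zero (hD.fibre t x)
      (fun s hs => (hd s hs).differentiableAt.differentiableWithinAt)
      (fun s hs => (hd s hs).deriv) h h'
  classical
  let f : Base → ℝ := fun z => if h : ∃ u, (z.1, z.2, u) ∈ D then F (z.1, z.2, h.choose) else 0
  have hf : ∀ p ∈ D, F p = f (base p) := by
    intro p hp
    have h : ∃ u, ((base p).1, (base p).2, u) ∈ D := ⟨p.2.2, hp⟩
    simp only [f, dif_pos h]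
    exact hconst _ _ _ _ hp h.choose_spec
  refine ⟨f, ?_, hf⟩
  rintro _ ⟨p, hp, rfl⟩
  -- The heights chosen in `f` may jump, but near `base p` the fixed height `p.2.2` stays in `D` and
  -- gives the same values.
  have hc : ContDiffAt ℝ ∞ (fun w : Base => ((w.1, w.2, p.2.2) : Total)) (base p) := by fun_prop
  have h1 : ContDiffAt ℝ ∞ (fun w : Base => F (w.1, w.2, p.2.2)) (base p) :=
    ContDiffAt.comp (base p) (g := F) (hF p hp) hc
  refine (h1.congr_of_eventuallyEq ?_).contDiffWithinAt
  filter_upwards [hc.continuousAt.eventually (hD.isOpen.mem_nhds (x := p) hp)] with w hw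
  exact (hf _ hw).symm

/-- A smooth function with vanishing `x`- and `u`-derivatives is a smooth function of `t`. -/
lemma exists_time_of_pd_eq_zero (hD : IsFibredDomain D) (hF : ∀ p ∈ D, ContDiffAt ℝ ∞ F p)
    (hx : ∀ p ∈ D, pd Ex F p = 0) (hu : ∀ p ∈ D, pd Eu F p = 0) :
    ∃ f : ℝ → ℝ, ContDiffOn ℝ ∞ f (Prod.fst '' D) ∧ ∀ p ∈ D, F p = f p.1 := by
  have hconst : ∀ (t : ℝ) (q q' : ℝ × ℝ), (t, q) ∈ D → (t, q') ∈ D → F (t, q) = F (t, q') := by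
    intro t q q' h h'
    have ho : IsOpen {q : ℝ × ℝ | (t, q.1, q.2) ∈ D} := hD.isOpen.preimage (by fun_prop)
    have hd : ∀ s : ℝ × ℝ, (t, s) ∈ D → HasFDerivAt (fun s => F (t, s)) (0 : ℝ × ℝ →L[ℝ] ℝ) s := by
      intro s hs
      have h1 : HasFDerivAt (fun s : ℝ × ℝ => ((t, s) : Total))
          (ContinuousLinearMap.inr ℝ ℝ (ℝ × ℝ)) s := hasFDerivAt_prodMk_right t s
      have h2 := HasFDerivAt.comp s (f := fun s : ℝ × ℝ => ((t, s) : Total))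
        ((hF _ hs).differentiableAt (by simp)).hasFDerivAt h1
      have h3 : (fderiv ℝ F (t, s)).comp (ContinuousLinearMap.inr ℝ ℝ (ℝ × ℝ)) = 0 := by
        ext
        · exact hx _ hs
        · exact hu _ hs
      rwa [h3] at h2
    exact ho.is_const_of_fderiv_eq_zero (𝕜 := ℝ) (hD.slice t)
      (fun s hs => (hd s hs).differentiableAt.differentiableWithinAt)
      (fun s hs => (hd s hs).fderiv) h h'
  classical
  let f : ℝ → ℝ := fun t => if h : ∃ q, (t, q) ∈ D then F (t, h.choose) else 0
  have hf : ∀ p ∈ D, F p = f p.1 := by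
    intro p hp
    have h : ∃ q, (p.1, q) ∈ D := ⟨p.2, hp⟩
    simp only [f, dif_pos h]
    exact hconst _ _ _ hp h.choose_spec
  refine ⟨f, ?_, hf⟩
  rintro _ ⟨p, hp, rfl⟩
  have hc : ContDiffAt ℝ ∞ (fun t : ℝ => ((t, p.2) : Total)) p.1 := by fun_prop
  have h1 : ContDiffAt ℝ ∞ (fun t : ℝ => F (t, p.2)) p.1 :=
    ContDiffAt.comp p.1 (g := F) (hF p hp) hc
  refine (h1.congr_of_eventuallyEq ?_).contDiffWithinAt
  filter_upwards [hc.continuousAt.eventually (hD.isOpen.mem_nhds (x := p) hp)] with w hw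
  exact (hf _ hw).symm

end Descent

end

/-! ### Transformations affine in `u`: jets, splitting and determining equations. -/

section

variable {D : Set Total} {φ : Total → Total} {θ θ' : Coeffs}

lemma pd_comp_base {f : Base → ℝ} {p : Total} (hf : DifferentiableAt ℝ f (base p)) (e : Total) :
    pd e (fun q => f (base q)) p = pd et f (base p) * e.1 + pd ex f (base p) * e.2.1 := by
  have h1 : HasFDerivAt (fun q : Total => q.1) (ContinuousLinearMap.fst ℝ ℝ (ℝ × ℝ)) p :=
    hasFDerivAt_fst
  have h2 : HasFDerivAt (fun q : Total => q.2.1)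
      ((ContinuousLinearMap.fst ℝ ℝ ℝ).comp (ContinuousLinearMap.snd ℝ ℝ (ℝ × ℝ))) p :=
    HasFDerivAt.fst (f₂ := fun q : Total => q.2) hasFDerivAt_snd
  have h := pd_comp_pair (e := e) (v := f) (z := p) hf h1.differentiableAt h2.differentiableAt
  rw [show pd e (fun q : Total => q.1) p = e.1 by rw [pd, h1.fderiv]; rfl,
    show pd e (fun q : Total => q.2.1) p = e.2.1 by rw [pd, h2.fderiv]; rfl] at h
  exact h

lemma pd_comp_fst {E : Type*} [NormedAddCommGroup E] [NormedSpace ℝ E] {f : ℝ → ℝ} {p : ℝ × E}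
    (hf : DifferentiableAt ℝ f p.1) (e : ℝ × E) :
    pd e (fun q : ℝ × E => f q.1) p = deriv f p.1 * e.1 := by
  have h : HasFDerivAt (fun q : ℝ × E => f q.1) _ p :=
    hf.hasFDerivAt.comp p (f := Prod.fst) (hasFDerivAt_fst (𝕜 := ℝ))
  rw [pd, h.fderiv]
  simp [mul_comm]

lemma pd_u (e p : Total) : pd e (fun q : Total => q.2.2) p = e.2.2 := by
  have h2 : HasFDerivAt (fun q : Total => q.2.2)
      ((ContinuousLinearMap.snd ℝ ℝ ℝ).comp (ContinuousLinearMap.snd ℝ ℝ (ℝ × ℝ))) p :=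
    HasFDerivAt.snd (f₂ := fun q : Total => q.2) hasFDerivAt_snd
  rw [pd, h2.fderiv]
  rfl

lemma pd_pd_mul_add {E : Type*} [NormedAddCommGroup E] [NormedSpace ℝ E] {f u g : E → ℝ} {z : E}
    (hf : ContDiffAt ℝ 2 f z) (hu : ContDiffAt ℝ 2 u z) (hg : ContDiffAt ℝ 2 g z) (e : E) :
    pd e (pd e (fun w => f w * u w + g w)) z = pd e (pd e f) z * u z + 2 * pd e f z * pd e u z
      + f z * pd e (pd e u) z + pd e (pd e g) z := by
  have h : pd e (fun w => f w * u w + g w) =ᶠ[𝓝 z]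
      fun w => (pd e f w * u w + f w * pd e u w) + pd e g w := by
    filter_upwards [eventually_contDiffAt_two hf, eventually_contDiffAt_two hu,
      eventually_contDiffAt_two hg] with w h1 h2 h3
    replace h1 := differentiableAt_of_two h1
    replace h2 := differentiableAt_of_two h2
    rw [pd_add (h1.fun_mul h2) (differentiableAt_of_two h3), pd_mul h1 h2]
  have df := differentiableAt_of_two hf
  have du := differentiableAt_of_two hu
  have dpf := differentiableAt_pd (e := e) hf
  have dpu := differentiableAt_pd (e := e) hu
  rw [pd_congr h, pd_add ((dpf.fun_mul du).fun_add (df.fun_mul dpu)) (differentiableAt_pd hg),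
    pd_add (dpf.fun_mul du) (df.fun_mul dpu), pd_mul dpf du, pd_mul df dpu]
  ring

/-- On `D`, `φ` is `(t, x, u) ↦ (T(t), X(t,x), U¹(t,x) u + U⁰(t,x))` with smooth `T`, `X`, `U¹`,
`U⁰`. -/
structure IsAffineForm (D : Set Total) (φ : Total → Total)
    (T : ℝ → ℝ) (X U1 U0 : Base → ℝ) : Prop where
  smooth_T : ContDiffOn ℝ ∞ T (Prod.fst '' D)
  smooth_X : ContDiffOn ℝ ∞ X (base '' D)
  smooth_U1 : ContDiffOn ℝ ∞ U1 (base '' D)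
  smooth_U0 : ContDiffOn ℝ ∞ U0 (base '' D)
  eq : ∀ p ∈ D, φ p = (T p.1, X (base p), U1 (base p) * p.2.2 + U0 (base p))

lemma contDiffAt_of_mem_base {f : Base → ℝ} (hD : IsOpen D) (hf : ContDiffOn ℝ ∞ f (base '' D))
    {z : Base} (hz : z ∈ base '' D) : ContDiffAt ℝ ∞ f z :=
  hf.contDiffAt ((isOpen_base_image hD).mem_nhds hz)

lemma contDiffAt_of_mem_fst {f : ℝ → ℝ} (hD : IsOpen D) (hf : ContDiffOn ℝ ∞ f (Prod.fst '' D))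
    {t : ℝ} (ht : t ∈ Prod.fst '' D) : ContDiffAt ℝ ∞ f t :=
  hf.contDiffAt ((isOpen_fst_image hD).mem_nhds ht)

lemma fst_mem_of_mem_base {z : Base} (hz : z ∈ base '' D) : z.1 ∈ Prod.fst '' D := by
  obtain ⟨p, hp, rfl⟩ := hz
  exact ⟨p, hp, rfl⟩

lemma pd_eq_of_eqOn {E : Type*} [NormedAddCommGroup E] [NormedSpace ℝ E] {S : Set E}
    (hS : IsOpen S) {F G : E → ℝ} (h : ∀ q ∈ S, F q = G q) {p : E} (hp : p ∈ S) (e : E) :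
    pd e F p = pd e G p :=
  pd_congr (by filter_upwards [hS.mem_nhds hp] with q hq using h q hq)

section

variable {T : ℝ → ℝ} {X U1 U0 : Base → ℝ}

/-- The Jacobian matrix is triangular with diagonal `T_t`, `X_x`, `U¹`, so full rank forces each to
be nonzero. -/
lemma IsAffineForm.nondegenerate (hD : IsOpen D) (hφ : IsPointTransformation D φ)
    (hF : IsAffineForm D φ T X U1 U0) {z : Base} (hz : z ∈ base '' D) :
    deriv T z.1 ≠ 0 ∧ pd ex X z ≠ 0 ∧ U1 z ≠ 0 := by
  have dT := (contDiffAt_of_mem_fst hD hF.smooth_T (fst_mem_of_mem_base hz)).differentiableAt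
    (by simp)
  have dX := (contDiffAt_of_mem_base hD hF.smooth_X hz).differentiableAt (by simp)
  have d1 := (contDiffAt_of_mem_base hD hF.smooth_U1 hz).differentiableAt (by simp)
  have d0 := (contDiffAt_of_mem_base hD hF.smooth_U0 hz).differentiableAt (by simp)
  obtain ⟨p, hp, rfl⟩ := hz
  have eP : ∀ e, pd e (fun q => (φ q).1) p = deriv T p.1 * e.1 := fun e => by
    rw [pd_eq_of_eqOn hD (fun q hq => by rw [hF.eq q hq]) hp (G := fun q => T q.1)]
    exact pd_comp_fst (p := p) dT e
  have eQ : ∀ e, pd e (fun q => (φ q).2.1) p = pd et X (base p) * e.1 + pd ex X (base p) * e.2.1 :=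
    fun e => by
    rw [pd_eq_of_eqOn hD (fun q hq => by rw [hF.eq q hq]) hp (G := fun q => X (base q))]
    exact pd_comp_base dX e
  have db : DifferentiableAt ℝ base p :=
    differentiableAt_fst.prodMk (DifferentiableAt.fst differentiableAt_snd)
  have eR : ∀ e, pd e (fun q => (φ q).2.2) p =
      (pd et U1 (base p) * e.1 + pd ex U1 (base p) * e.2.1) * p.2.2 + U1 (base p) * e.2.2
        + (pd et U0 (base p) * e.1 + pd ex U0 (base p) * e.2.1) := fun e => by
    have du : DifferentiableAt ℝ (fun q : Total => q.2.2) p := by fun_prop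
    have d1' : DifferentiableAt ℝ (fun q => U1 (base q)) p := d1.comp p db
    have d0' : DifferentiableAt ℝ (fun q => U0 (base q)) p := d0.comp p db
    rw [pd_eq_of_eqOn hD (fun q hq => by rw [hF.eq q hq]) hp
      (G := fun q => U1 (base q) * q.2.2 + U0 (base q)), pd_add (d1'.fun_mul du) d0', pd_mul d1' du,
      pd_comp_base d1, pd_comp_base d0, pd_u]
  have hT : deriv T p.1 ≠ 0 := by
    obtain ⟨e, h1, -, -⟩ := hφ.exists_direction hD hp (1, 0, 0)
    rw [eP] at h1
    exact left_ne_zero_of_mul_eq_one h1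
  have hX : pd ex X (base p) ≠ 0 := by
    obtain ⟨e, h1, h2, -⟩ := hφ.exists_direction hD hp (0, 1, 0)
    rw [eP] at h1
    rw [eQ, (mul_eq_zero.1 h1).resolve_left hT, mul_zero, zero_add] at h2
    exact left_ne_zero_of_mul_eq_one h2
  refine ⟨hT, hX, ?_⟩
  obtain ⟨e, h1, h2, h3⟩ := hφ.exists_direction hD hp (0, 0, 1)
  rw [eP] at h1
  have e1 := (mul_eq_zero.1 h1).resolve_left hT
  rw [eQ, e1, mul_zero, zero_add] at h2
  have e2 := (mul_eq_zero.1 h2).resolve_left hX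
  rw [eR, e1, e2] at h3
  exact left_ne_zero_of_mul_eq_one (a := U1 (base p)) (b := e.2.2)
    (by simpa using h3)

variable {u v : Base → ℝ} {z : Base}

lemma IsAffineForm.base_eq (hF : IsAffineForm D φ T X U1 U0) (hz : graphPt u z ∈ D) :
    base (φ (graphPt u z)) = (T z.1, X z) := by rw [hF.eq _ hz]; rfl

lemma eventually_graphPt_mem (hD : IsOpen D) (hu : ContDiffAt ℝ ∞ u z) (hz : graphPt u z ∈ D) :
    ∀ᶠ w in 𝓝 z, graphPt u w ∈ D :=
  (contDiffAt_graphPt hu).continuousAt.eventually (hD.mem_nhds hz)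

/-- The jet of the transformed function. -/
lemma IsAffineForm.jet (hD : IsOpen D) (hF : IsAffineForm D φ T X U1 U0)
    (h : MapsGraph D φ u v z) :
    v (T z.1, X z) = U1 z * u z + U0 z ∧
    pd et U1 z * u z + U1 z * pd et u z + pd et U0 z =
      pd et v (T z.1, X z) * deriv T z.1 + pd ex v (T z.1, X z) * pd et X z ∧
    pd ex U1 z * u z + U1 z * pd ex u z + pd ex U0 z = pd ex v (T z.1, X z) * pd ex X z ∧
    pd ex (pd ex U1) z * u z + 2 * pd ex U1 z * pd ex u z + U1 z * pd ex (pd ex u) z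
      + pd ex (pd ex U0) z = pd ex (pd ex v) (T z.1, X z) * pd ex X z ^ 2
        + pd ex v (T z.1, X z) * pd ex (pd ex X) z := by
  have hz : z ∈ base '' D := ⟨_, h.mem, rfl⟩
  have le : (2 : WithTop ℕ∞) ≤ ∞ := WithTop.coe_le_coe.2 le_top
  have cT := (contDiffAt_of_mem_fst hD hF.smooth_T (fst_mem_of_mem_base hz)).of_le le
  have cX := (contDiffAt_of_mem_base hD hF.smooth_X hz).of_le le
  have c1 := (contDiffAt_of_mem_base hD hF.smooth_U1 hz).of_le le
  have c0 := (contDiffAt_of_mem_base hD hF.smooth_U0 hz).of_le le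
  have cu := h.smooth_source.of_le le
  have cv := h.smooth_target.of_le le
  rw [hF.base_eq h.mem] at cv
  have cτ : ContDiffAt ℝ 2 (fun w : Base => T w.1) z :=
    ContDiffAt.comp z (f := Prod.fst) cT contDiffAt_fst
  have hev : (fun w => U1 w * u w + U0 w) =ᶠ[𝓝 z] fun w => v (T w.1, X w) := by
    filter_upwards [h.eventually_eq_comp, eventually_graphPt_mem hD h.smooth_source h.mem]
      with w hw hm
    rw [hF.eq _ hm] at hw
    exact hw
  have τx : pd ex (fun w : Base => T w.1) =ᶠ[𝓝 z] fun _ => 0 := by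
    filter_upwards [(isOpen_base_image hD).mem_nhds hz] with w hw
    rw [pd_comp_fst ((contDiffAt_of_mem_fst hD hF.smooth_T
      (fst_mem_of_mem_base hw)).differentiableAt (by simp)), mul_zero]
  have dT := cT.differentiableAt (by simp)
  have dX := differentiableAt_of_two cX
  have dv := differentiableAt_of_two cv
  have d1 := differentiableAt_of_two c1
  have d0 := differentiableAt_of_two c0
  have du := differentiableAt_of_two cu
  have dτ := differentiableAt_of_two cτ
  have first : ∀ e : Base, pd e U1 z * u z + U1 z * pd e u z + pd e U0 z =
      pd et v (T z.1, X z) * (deriv T z.1 * e.1) + pd ex v (T z.1, X z) * pd e X z := by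
    intro e
    rw [← pd_comp_fst dT e, ← pd_comp_pair (f := fun w : Base => T w.1) dv dτ dX, ← pd_congr hev,
      pd_add (d1.fun_mul du) d0, pd_mul d1 du]
  refine ⟨hev.self_of_nhds.symm, by simpa using first et, by simpa using first ex, ?_⟩
  rw [← pd_pd_mul_add c1 cu c0, pd_pd_comp_pair (f := fun w : Base => T w.1) cv cτ cX hev,
    pd_congr τx, τx.self_of_nhds]
  simp [pd]
  ring

/-- Here the total Jacobian is `T_t X_x`, whatever the jet of `u`, so no transversality condition is
left. -/
lemma IsAffineForm.exists_mapsGraph (hD : IsOpen D) (hφ : IsPointTransformation D φ)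
    (hF : IsAffineForm D φ T X U1 U0) (hu : ContDiffAt ℝ ∞ u z) (hz : graphPt u z ∈ D) :
    ∃ v, MapsGraph D φ u v z := by
  have hz' : z ∈ base '' D := ⟨_, hz, rfl⟩
  have dT := (contDiffAt_of_mem_fst hD hF.smooth_T (fst_mem_of_mem_base hz')).differentiableAt
    (by simp)
  have hev := eventually_graphPt_mem hD hu hz
  have e1 : (fun w => (φ (graphPt u w)).1) =ᶠ[𝓝 z] fun w => T w.1 := by
    filter_upwards [hev] with w hw
    rw [hF.eq _ hw, graphPt]
  have e2 : (fun w => (φ (graphPt u w)).2.1) =ᶠ[𝓝 z] X := by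
    filter_upwards [hev] with w hw
    rw [hF.eq _ hw]
    rfl
  refine VarBurgers.exists_mapsGraph hD hφ hu hz ?_
  obtain ⟨h1, h2, -⟩ := hF.nondegenerate hD hφ hz'
  rw [pd_congr e1, pd_congr e1, pd_congr e2, pd_comp_fst dT, pd_comp_fst dT]
  simpa using And.intro h1 h2

/-- A quadratic polynomial vanishing on a neighbourhood of a point has zero coefficients. -/
lemma coeffs_eq_zero_of_eventually {α β γ m : ℝ}
    (h : ∀ᶠ s in 𝓝 m, α + β * s + γ * s ^ 2 = 0) : α = 0 ∧ β = 0 ∧ γ = 0 := by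
  obtain ⟨ε, hε, hb⟩ := Metric.eventually_nhds_iff.1 h
  have h0 := hb (y := m) (by simpa using hε)
  -- The three points `m`, `m ± ε / 2` determine a quadratic: second difference for `γ`, first
  -- difference for `β`.
  have h1 := hb (y := m + ε / 2) (by simp [abs_of_pos hε]; linarith)
  have h2 := hb (y := m - ε / 2) (by simp [abs_of_pos hε]; linarith)
  have hγ : γ = 0 := by
    refine (mul_eq_zero.1 (?_ : γ * ε ^ 2 = 0)).resolve_right (by positivity)
    linear_combination 2 * h1 + 2 * h2 - 4 * h0
  have hβ : β = 0 := by
    refine (mul_eq_zero.1 (?_ : β * ε = 0)).resolve_right hε.ne'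
    linear_combination h1 - h2 - 2 * m * ε * hγ
  refine ⟨?_, hβ, hγ⟩
  linear_combination h0 - m * hβ - m ^ 2 * hγ

/-- Relations obtained by splitting the transformed equation with respect to the jet variables. -/
lemma Connects.determining_aux (hD : IsOpen D) (hφ : IsPointTransformation D φ)
    (hθ : θ.InClass (base '' D)) (h : Connects D φ θ θ')
    (hF : IsAffineForm D φ T X U1 U0) {z : Base} (hz : z ∈ base '' D) :
    θ'.A2 (T z.1, X z) * deriv T z.1 = θ.A2 z * pd ex X z ^ 2 ∧
    θ'.C (T z.1, X z) * deriv T z.1 * U1 z = θ.C z * pd ex X z ∧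
    pd ex U1 z = 0 ∧
    pd et X z * U1 z = θ.A2 z * pd ex (pd ex X) z * U1 z + U0 z * θ.C z * pd ex X z ∧
    θ.C z * pd ex U0 z + pd et U1 z = θ.A2 z * pd ex (pd ex U1) z ∧
    pd et U0 z = θ.A2 z * pd ex (pd ex U0) z := by
  obtain ⟨hT, hX, hU⟩ := hF.nondegenerate hD hφ hz
  have hA := hθ.A2_ne_zero hz
  have hC := hθ.C_ne_zero hz
  -- On the equation, `u`, `u_x` and `u_xx` are free parameters `m`, `b`, `c`, and `u_t` is
  -- determined by them.
  have key : ∀ m b c : ℝ, (z.1, z.2, m) ∈ D → ∃ vt vx vxx : ℝ,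
      vt + θ'.C (T z.1, X z) * (U1 z * m + U0 z) * vx = θ'.A2 (T z.1, X z) * vxx ∧
      pd et U1 z * m + U1 z * (θ.A2 z * c - θ.C z * m * b) + pd et U0 z =
        vt * deriv T z.1 + vx * pd et X z ∧
      pd ex U1 z * m + U1 z * b + pd ex U0 z = vx * pd ex X z ∧
      pd ex (pd ex U1) z * m + 2 * pd ex U1 z * b + U1 z * c + pd ex (pd ex U0) z =
        vxx * pd ex X z ^ 2 + vx * pd ex (pd ex X) z := by
    intro m b c hm
    obtain ⟨v, hv⟩ := hF.exists_mapsGraph (z := z)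
      (u := quad z m (θ.A2 z * c - θ.C z * m * b) b c 0) hD hφ (contDiff_quad ..).contDiffAt
      (by rwa [graphPt_quad])
    obtain ⟨j0, j1, j2, j3⟩ := hF.jet hD hv
    have sv := (h _ _ _ hv).1 (satisfiedAt_quad.2 (by ring))
    rw [hv.satisfiedAt_iff _ rfl, ← hv.value, hF.base_eq hv.mem, j0] at sv
    simp only [pd_pd_quad, pd_quad, quad_self, sub_self, mul_zero, add_zero, zero_mul, one_mul,
      zero_add] at sv j1 j2 j3
    exact ⟨_, _, _, sv, j1, j2, j3⟩
  obtain ⟨⟨t, x, m⟩, hp, rfl⟩ := hz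
  set z := base (t, x, m) with hzdef
  have hm : ∀ᶠ s in 𝓝 m, (z.1, z.2, s) ∈ D := by
    have hc : Tendsto (fun s : ℝ => ((z.1, z.2, s) : Total)) (𝓝 m) (𝓝 (t, x, m)) :=
      Continuous.tendsto' (by fun_prop) _ _ rfl
    exact hc.eventually (hD.mem_nhds hp)
  -- Coefficient of `u_xx`.
  have r1 : θ'.A2 (T z.1, X z) * deriv T z.1 = θ.A2 z * pd ex X z ^ 2 := by
    obtain ⟨v1, v2, v3, e1, e2, e3, e4⟩ := key m 0 0 hp
    obtain ⟨w1, w2, w3, f1, f2, f3, f4⟩ := key m 0 1 hp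
    have d2 : w2 = v2 := mul_right_cancel₀ hX (by linear_combination e3 - f3)
    refine mul_left_cancel₀ hU ?_
    linear_combination (θ'.A2 (T z.1, X z) * deriv T z.1) * (f4 - e4)
      - pd ex X z ^ 2 * (f2 - e2) - deriv T z.1 * pd ex X z ^ 2 * (f1 - e1)
      + (θ'.A2 (T z.1, X z) * deriv T z.1 * pd ex (pd ex X) z - pd ex X z ^ 2 * pd et X z
        + deriv T z.1 * pd ex X z ^ 2 * θ'.C (T z.1, X z) * (U1 z * m + U0 z)) * d2
  -- Coefficient of `u_x`, an affine function of `u = s`; the zero quadratic term fits the shape of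
  -- `coeffs_eq_zero_of_eventually`.
  have hlin : ∀ᶠ s in 𝓝 m, (-pd et X z * U1 z + θ'.C (T z.1, X z) * deriv T z.1 * U0 z * U1 z
      - θ.A2 z * (2 * pd ex U1 z * pd ex X z - U1 z * pd ex (pd ex X) z))
      + (θ'.C (T z.1, X z) * deriv T z.1 * U1 z - θ.C z * pd ex X z) * U1 z * s
      + 0 * s ^ 2 = 0 := by
    filter_upwards [hm] with s hs
    obtain ⟨v1, v2, v3, e1, e2, e3, e4⟩ := key s 0 0 hs
    obtain ⟨w1, w2, w3, f1, f2, f3, f4⟩ := key s 1 0 hs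
    have d2 : (w2 - v2) * pd ex X z = U1 z := by linear_combination e3 - f3
    linear_combination pd ex X z * (deriv T z.1 * (f1 - e1) + (f2 - e2) + (w3 - v3) * r1
      - θ.A2 z * (f4 - e4)) - (-pd et X z + θ'.C (T z.1, X z) * deriv T z.1 * (U1 z * s + U0 z)
      + θ.A2 z * pd ex (pd ex X) z) * d2
  obtain ⟨l0, l1, -⟩ := coeffs_eq_zero_of_eventually hlin
  have r2 : θ'.C (T z.1, X z) * deriv T z.1 * U1 z = θ.C z * pd ex X z :=
    sub_eq_zero.1 ((mul_eq_zero.1 l1).resolve_right hU)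
  -- The part free of `u_x` and `u_xx`, with `X_t` eliminated by `l0` and `r2`. It is quadratic in
  -- `u`, and its leading coefficient `C U¹ U¹_x` forces `U¹_x = 0`.
  have hquad : ∀ᶠ s in 𝓝 m,
      (U1 z * (pd et U0 z - θ.A2 z * pd ex (pd ex U0) z) + 2 * θ.A2 z * pd ex U1 z * pd ex U0 z)
      + (U1 z * (pd et U1 z - θ.A2 z * pd ex (pd ex U1) z) + 2 * θ.A2 z * pd ex U1 z * pd ex U1 z
        + θ.C z * U1 z * pd ex U0 z) * s
      + θ.C z * U1 z * pd ex U1 z * s ^ 2 = 0 := by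
    filter_upwards [hm] with s hs
    obtain ⟨v1, v2, v3, e1, e2, e3, e4⟩ := key s 0 0 hs
    refine (mul_eq_zero.1 ?_).resolve_right hX
    linear_combination U1 z * pd ex X z * (deriv T z.1 * e1 + e2 + v3 * r1 - θ.A2 z * e4)
      + U1 z * (-pd et X z + θ'.C (T z.1, X z) * deriv T z.1 * (U1 z * s + U0 z)
        + θ.A2 z * pd ex (pd ex X) z) * e3
      - (pd ex U1 z * s + pd ex U0 z) * (l0 + U1 z * s * r2)
  obtain ⟨q0, q1, q2⟩ := coeffs_eq_zero_of_eventually hquad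
  have hU1x : pd ex U1 z = 0 := (mul_eq_zero.1 q2).resolve_left (mul_ne_zero hC hU)
  rw [hU1x] at q0 q1 l0
  refine ⟨r1, r2, hU1x, ?_, mul_left_cancel₀ hU ?_, mul_left_cancel₀ hU ?_⟩
  · linear_combination U0 z * r2 - l0
  · linear_combination q1
  · linear_combination q0

/-- The determining equations and the transformation of the arbitrary elements, deduced from the
transformation of the equation. -/
lemma Connects.determining (hD : IsOpen D) (hφ : IsPointTransformation D φ)
    (hθ : θ.InClass (base '' D)) (h : Connects D φ θ θ')
    (hF : IsAffineForm D φ T X U1 U0) {z : Base} (hz : z ∈ base '' D) :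
    θ'.A2 (T z.1, X z) * deriv T z.1 = θ.A2 z * pd ex X z ^ 2 ∧
    θ'.C (T z.1, X z) * deriv T z.1 * U1 z = θ.C z * pd ex X z ∧
    pd ex U1 z = 0 ∧
    pd et X z * U1 z = θ.A2 z * pd ex (pd ex X) z * U1 z + U0 z * θ.C z * pd ex X z ∧
    θ.C z * pd ex U0 z = -pd et U1 z ∧
    pd et U0 z = θ.A2 z * pd ex (pd ex U0) z := by
  obtain ⟨h1, h2, h3, h4, h5, h6⟩ := h.determining_aux hD hφ hθ hF hz
  -- Removing `U¹_xx` needs `U¹_x = 0` on a neighbourhood, not just at `z`.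
  have h0 : pd ex (pd ex U1) z = 0 := pd_eq_zero_of_forall (isOpen_base_image hD)
    (fun w hw => (h.determining_aux hD hφ hθ hF hw).2.2.1) hz
  exact ⟨h1, h2, h3, h4, by linear_combination h5 + θ.A2 z * h0, h6⟩

/-- Transformation of the equation when the determining equations hold. -/
lemma IsAffineForm.satisfiedAt_iff (hD : IsOpen D) (hφ : IsPointTransformation D φ)
    (hF : IsAffineForm D φ T X U1 U0) (h : MapsGraph D φ u v z)
    (hA2 : θ'.A2 (T z.1, X z) * deriv T z.1 = θ.A2 z * pd ex X z ^ 2)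
    (hC : θ'.C (T z.1, X z) * deriv T z.1 * U1 z = θ.C z * pd ex X z)
    (hU1 : pd ex U1 z = 0) (hU1' : pd ex (pd ex U1) z = 0)
    (hX : pd et X z * U1 z = θ.A2 z * pd ex (pd ex X) z * U1 z + U0 z * θ.C z * pd ex X z)
    (hU0 : θ.C z * pd ex U0 z = -pd et U1 z)
    (hU0' : pd et U0 z = θ.A2 z * pd ex (pd ex U0) z) :
    θ.SatisfiedAt u z ↔ θ'.SatisfiedAt v (base (φ (graphPt u z))) := by
  obtain ⟨nT, nX, nU⟩ := hF.nondegenerate hD hφ ⟨_, h.mem, rfl⟩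
  obtain ⟨j0, j1, j2, j3⟩ := hF.jet hD h
  rw [h.satisfiedAt_iff _ rfl, ← h.value, hF.base_eq h.mem, j0,
    Coeffs.satisfiedAt_iff (h.smooth_source.of_le (WithTop.coe_le_coe.2 le_top))]
  rw [hU1] at j2 j3
  rw [hU1'] at j3
  -- `T_t` times the target residual equals `U¹` times the source residual; the extra factor `U1 z`
  -- avoids dividing in `hX`.
  have key : U1 z * (deriv T z.1 * (pd et v (T z.1, X z)
      + θ'.C (T z.1, X z) * (U1 z * u z + U0 z) * pd ex v (T z.1, X z)
      - θ'.A2 (T z.1, X z) * pd ex (pd ex v) (T z.1, X z))) =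
      U1 z * (U1 z * (pd et u z + θ.C z * u z * pd ex u z - θ.A2 z * pd ex (pd ex u) z)) := by
    linear_combination -U1 z * j1 - U1 z * pd ex (pd ex v) (T z.1, X z) * hA2
      + U1 z * θ.A2 z * j3 + (U1 z * u z + U0 z) * pd ex v (T z.1, X z) * hC
      - pd ex v (T z.1, X z) * hX - θ.C z * U1 z * u z * j2 + U1 z * u z * hU0 + U1 z * hU0'
  replace key := mul_left_cancel₀ nU key
  rw [← sub_eq_zero, ← sub_eq_zero (a := _ + θ'.C _ * _ * _)]
  constructor
  · intro hs
    rw [hs, mul_zero] at key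
    exact (mul_eq_zero.1 key).resolve_left nT
  · intro hs
    rw [hs, mul_zero] at key
    exact (mul_eq_zero.1 key.symm).resolve_left nU

end

end

/-! ### Existence and uniqueness of the target equation, and the normal form. -/

section

variable {D : Set Total} {φ : Total → Total} {θ θ' : Coeffs}
  {T U1 : ℝ → ℝ} {X U0 : Base → ℝ}

lemma HasForm.isAffineForm (h : HasForm D φ T X U1 U0) :
    IsAffineForm D φ T X (fun z => U1 z.1) U0 where
  smooth_T := h.smooth_T
  smooth_X := h.smooth_X
  smooth_U1 := h.smooth_U1.comp contDiffOn_fst fun _ hz => fst_mem_of_mem_base hz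
  smooth_U0 := h.smooth_U0
  eq p hp := h.eq p.1 p.2.1 p.2.2 hp

lemma dx_dx_eq_of_smooth {f : Base → ℝ} {z : Base} (hf : ContDiffAt ℝ ∞ f z) :
    dx (dx f) z = pd ex (pd ex f) z := dx_dx_eq_pd (hf.of_le (WithTop.coe_le_coe.2 le_top))

lemma dx_eq_of_smooth {f : Base → ℝ} {z : Base} (hf : ContDiffAt ℝ ∞ f z) :
    dx f z = pd ex f z := dx_eq_pd (hf.differentiableAt (by simp))

lemma dt_eq_of_smooth {f : Base → ℝ} {z : Base} (hf : ContDiffAt ℝ ∞ f z) :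
    dt f z = pd et f z := dt_eq_pd (hf.differentiableAt (by simp))

lemma HasForm.connects_iff_related (hD : IsOpen D) (hφ : IsPointTransformation D φ)
    (hθ : θ.InClass (base '' D)) (hF : HasForm D φ T X U1 U0)
    (hdet : Determining θ (base '' D) X U1 U0) :
    Connects D φ θ θ' ↔ Related θ θ' (base '' D) T X U1 := by
  have hA := hF.isAffineForm
  have cX := fun z (hz : z ∈ base '' D) => contDiffAt_of_mem_base hD hF.smooth_X hz
  have c0 := fun z (hz : z ∈ base '' D) => contDiffAt_of_mem_base hD hF.smooth_U0 hz
  have c1 := fun z (hz : z ∈ base '' D) => (contDiffAt_of_mem_fst hD hF.smooth_U1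
    (fst_mem_of_mem_base hz)).differentiableAt (by simp)
  constructor
  · intro h
    constructor
    · intro z hz
      obtain ⟨nT, -, nU⟩ := hA.nondegenerate hD hφ hz
      obtain ⟨-, h2, -⟩ := h.determining hD hφ hθ hA hz
      rw [dx_eq_of_smooth (cX z hz)]
      field_simp
      linear_combination h2
    · intro z hz
      obtain ⟨nT, -, -⟩ := hA.nondegenerate hD hφ hz
      obtain ⟨h1, -⟩ := h.determining hD hφ hθ hA hz
      rw [dx_eq_of_smooth (cX z hz)]
      field_simp
      linear_combination h1
  · intro hr u v z hm
    have hz : z ∈ base '' D := ⟨_, hm.mem, rfl⟩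
    obtain ⟨nT, nX, nU⟩ := hA.nondegenerate hD hφ hz
    have e1 := hr.eq_C z hz
    have e2 := hr.eq_A2 z hz
    have d1 := hdet.eq_X z hz
    have d2 := hdet.eq_U1 z hz
    have d3 := hdet.eq_U0 z hz
    rw [dx_eq_of_smooth (cX z hz)] at e1 e2 d1
    rw [dx_dx_eq_of_smooth (cX z hz), dt_eq_of_smooth (cX z hz)] at d1
    rw [dx_eq_of_smooth (c0 z hz)] at d2
    rw [dx_dx_eq_of_smooth (c0 z hz), dt_eq_of_smooth (c0 z hz)] at d3
    have hx0 : ∀ w ∈ base '' D, pd ex (fun w : Base => U1 w.1) w = 0 := fun w hw => by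
      rw [pd_comp_fst (c1 w hw), mul_zero]
    refine hA.satisfiedAt_iff hD hφ hm ?_ ?_ (hx0 z hz)
      (pd_eq_zero_of_forall (isOpen_base_image hD) hx0 hz) ?_ ?_ d3
    · rw [e2]; field_simp
    · rw [e1]; field_simp
    · rw [d1]; field_simp
    · rw [d2, pd_comp_fst (c1 z hz), mul_one]

/-- A map `(t, x) ↦ (T(t), X(t,x))` with `T_t ≠ 0`, `X_x ≠ 0` is injective on the projection of a
fibred domain. -/
lemma HasForm.injOn (hD : IsFibredDomain D) (hF : HasForm D φ T X U1 U0) :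
    InjOn (fun z : Base => (T z.1, X z)) (base '' D) := by
  have hT : InjOn T (Prod.fst '' D) := by
    intro s hs t ht hst
    by_contra hne
    wlog hlt : s < t generalizing s t
    · exact this ht hs hst.symm (Ne.symm hne) (lt_of_le_of_ne (not_lt.1 hlt) (Ne.symm hne))
    have hsub : Icc s t ⊆ Prod.fst '' D :=
      -- The projection of `D` to the `t`-axis is an interval, so Rolle's theorem applies to `T`;
      -- below, connected `t`-sections serve the same purpose for `X`.
      (hD.isPreconnected.image _ continuous_fst.continuousOn).Icc_subset hs ht
    obtain ⟨c, hc, hd⟩ := exists_deriv_eq_zero hlt (hF.smooth_T.continuousOn.mono hsub) hst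
    obtain ⟨p, hp, rfl⟩ := hsub (Ioo_subset_Icc_self hc)
    exact hF.ne_zero (base p) ⟨p, hp, rfl⟩ (by
      rw [show deriv T (base p).1 = 0 from hd, zero_mul, zero_mul])
  intro z hz w hw hzw
  have h1 : z.1 = w.1 := hT (fst_mem_of_mem_base hz) (fst_mem_of_mem_base hw)
    (congrArg Prod.fst hzw)
  have h2 : X z = X w := congrArg Prod.snd hzw
  refine Prod.ext h1 ?_
  by_contra hne
  wlog hlt : z.2 < w.2 generalizing z w
  · exact this hw hz hzw.symm h1.symm h2.symm (Ne.symm hne)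
      (lt_of_le_of_ne (not_lt.1 hlt) (Ne.symm hne))
  have hmem : ∀ {y}, y ∈ base '' D → y.1 = z.1 →
      y.2 ∈ Prod.fst '' {q : ℝ × ℝ | (z.1, q.1, q.2) ∈ D} := by
    rintro _ ⟨p, hp, rfl⟩ hy
    exact ⟨p.2, by rw [← hy]; exact hp, rfl⟩
  have hsub : ∀ y ∈ Icc z.2 w.2, (z.1, y) ∈ base '' D := by
    intro y hy
    obtain ⟨q, hq, rfl⟩ := ((hD.slice z.1).image _ continuous_fst.continuousOn).Icc_subset
      (hmem hz rfl) (hmem hw h1.symm) hy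
    exact ⟨_, hq, rfl⟩
  obtain ⟨c, hc, hd⟩ := exists_deriv_eq_zero (f := fun y => X (z.1, y)) hlt
    (hF.smooth_X.continuousOn.comp (Continuous.prodMk_right z.1).continuousOn hsub)
    (by rw [h2, h1])
  exact hF.ne_zero (z.1, c) (hsub c (Ioo_subset_Icc_self hc)) (by
    rw [show dx X (z.1, c) = 0 from hd, mul_zero, zero_mul])

lemma HasForm.base_image (hF : HasForm D φ T X U1 U0) :
    base '' (φ '' D) = (fun z : Base => (T z.1, X z)) '' (base '' D) := by
  rw [image_image, image_image]
  exact image_congr fun p hp => by rw [hF.isAffineForm.eq p hp]; rfl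

lemma contDiffOn_dx {f : Base → ℝ} {Ω : Set Base} (hΩ : IsOpen Ω) (hf : ContDiffOn ℝ ∞ f Ω) :
    ContDiffOn ℝ ∞ (dx f) Ω := by
  intro z hz
  have h1 : ContDiffAt ℝ ∞ (pd ex f) z := contDiffAt_pd (hf.contDiffAt (hΩ.mem_nhds hz)) le_rfl
  refine (h1.congr_of_eventuallyEq ?_).contDiffWithinAt
  filter_upwards [hΩ.mem_nhds hz] with w hw
  exact dx_eq_of_smooth (hf.contDiffAt (hΩ.mem_nhds hw))

/-- A smooth function of the old variables is a smooth function of the new ones. -/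
lemma HasForm.contDiffOn_comp_inv (hD : IsFibredDomain D) (hφ : IsPointTransformation D φ)
    (hF : HasForm D φ T X U1 U0) {G : Base → ℝ} (hG : ContDiffOn ℝ ∞ G (base '' D)) :
    ContDiffOn ℝ ∞
      (fun y => G (Function.invFunOn (fun z : Base => (T z.1, X z)) (base '' D) y))
      (base '' (φ '' D)) := by
  rw [hF.base_image]
  rintro _ ⟨z, hz, rfl⟩
  have hΩ := isOpen_base_image hD.isOpen
  obtain ⟨nT, nX, -⟩ := hF.isAffineForm.nondegenerate hD.isOpen hφ hz
  have cT := contDiffAt_of_mem_fst hD.isOpen hF.smooth_T (fst_mem_of_mem_base hz)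
  have cX := contDiffAt_of_mem_base hD.isOpen hF.smooth_X hz
  have dT := cT.differentiableAt (by simp)
  obtain ⟨σ, hσ, hσz, -, hr⟩ := exists_local_inverse (f := fun w : Base => T w.1)
    (cT.comp z contDiffAt_fst) cX
    (by rw [pd_comp_fst dT, pd_comp_fst dT]; simpa using And.intro nT nX)
  have hGσ : ContDiffAt ℝ ∞ (fun y => G (σ y)) (T z.1, X z) :=
    ContDiffAt.comp _ (by rw [hσz]; exact hG.contDiffAt (hΩ.mem_nhds hz)) hσ
  refine (hGσ.congr_of_eventuallyEq ?_).contDiffWithinAt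
  -- `σ` takes values in the set where `(T, X)` is injective, so the global inverse coincides with
  -- the smooth local one near this point.
  have hmem : ∀ᶠ y in 𝓝 (T z.1, X z), σ y ∈ base '' D :=
    hσ.continuousAt.eventually (by rw [hσz]; exact hΩ.mem_nhds hz)
  filter_upwards [hr, hmem] with y hy hm
  congr 1
  conv_lhs => rw [← hy]
  exact (hF.injOn hD).leftInvOn_invFunOn hm

/-- The formulas prescribe the new coefficients at new points in terms of old ones; injectivity of
`(T, X)` makes them well defined, and its inverse makes them smooth. -/
lemma HasForm.exists_related (hD : IsFibredDomain D) (hφ : IsPointTransformation D φ)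
    (hθ : θ.InClass (base '' D)) (hF : HasForm D φ T X U1 U0) :
    ∃ θ' : Coeffs, θ'.InClass (base '' (φ '' D)) ∧ Related θ θ' (base '' D) T X U1 := by
  have hΩ := isOpen_base_image hD.isOpen
  have sX := contDiffOn_dx hΩ hF.smooth_X
  have sT : ContDiffOn ℝ ∞ (fun z : Base => deriv T z.1) (base '' D) :=
    (hF.smooth_T.deriv_of_isOpen (m := ∞) (isOpen_fst_image hD.isOpen) le_rfl).comp
      contDiffOn_fst fun _ hz => fst_mem_of_mem_base hz
  have s1 := hF.isAffineForm.smooth_U1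
  have nT : ∀ z ∈ base '' D, deriv T z.1 ≠ 0 := fun z hz =>
    left_ne_zero_of_mul (left_ne_zero_of_mul (hF.ne_zero z hz))
  have nX : ∀ z ∈ base '' D, dx X z ≠ 0 := fun z hz =>
    right_ne_zero_of_mul (left_ne_zero_of_mul (hF.ne_zero z hz))
  have n1 : ∀ z ∈ base '' D, U1 z.1 ≠ 0 := fun z hz => right_ne_zero_of_mul (hF.ne_zero z hz)
  let ι := Function.invFunOn (fun z : Base => (T z.1, X z)) (base '' D)
  have hι : ∀ z ∈ base '' D, ι (T z.1, X z) = z := fun z hz =>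
    (hF.injOn hD).leftInvOn_invFunOn hz
  refine ⟨⟨fun y => dx X (ι y) ^ 2 / deriv T (ι y).1 * θ.A2 (ι y),
    fun y => dx X (ι y) / (deriv T (ι y).1 * U1 (ι y).1) * θ.C (ι y)⟩, ⟨?_, ?_, ?_⟩, ⟨?_, ?_⟩⟩
  · exact hF.contDiffOn_comp_inv hD hφ
      (G := fun z => dx X z ^ 2 / deriv T z.1 * θ.A2 z) (((sX.pow 2).div sT nT).mul hθ.smooth_A2)
  · exact hF.contDiffOn_comp_inv hD hφ
      (G := fun z => dx X z / (deriv T z.1 * U1 z.1) * θ.C z)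
      ((sX.div (sT.mul s1) fun z hz => mul_ne_zero (nT z hz) (n1 z hz)).mul hθ.smooth_C)
  · rw [hF.base_image]
    rintro _ ⟨z, hz, rfl⟩
    simp only [hι z hz]
    exact mul_ne_zero
      (mul_ne_zero (div_ne_zero (pow_ne_zero 2 (nX z hz)) (nT z hz)) (hθ.A2_ne_zero hz))
      (mul_ne_zero (div_ne_zero (nX z hz) (mul_ne_zero (nT z hz) (n1 z hz))) (hθ.C_ne_zero hz))
  · intro z hz
    simp only [hι z hz]
  · intro z hz
    simp only [hι z hz]

/-- Since `R_uu = 0`, both `R_u` and `R - u R_u` descend to functions of `(t, x)`; these are `U¹`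
and `U⁰`. -/
lemma Connects.exists_isAffineForm (hD : IsFibredDomain D) (hφ : IsPointTransformation D φ)
    (hθ : θ.InClass (base '' D)) (hθ' : θ'.InClass (base '' (φ '' D))) (h : Connects D φ θ θ') :
    ∃ (T : ℝ → ℝ) (X U1 U0 : Base → ℝ), IsAffineForm D φ T X U1 U0 := by
  have hO := hD.isOpen
  have hPx : ∀ p ∈ D, pd Ex (fun q => (φ q).1) p = 0 := fun p hp =>
    (h.time_only hO hφ hθ hθ' hp).1
  have hPu : ∀ p ∈ D, pd Eu (fun q => (φ q).1) p = 0 := fun p hp =>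
    (h.time_only hO hφ hθ hθ' hp).2
  have hPt : ∀ p ∈ D, pd Et (fun q => (φ q).1) p ≠ 0 := fun p hp h0 => by
    obtain ⟨e, h1, -⟩ := hφ.exists_direction hO hp (1, 0, 0)
    rw [pd_total, h0, hPx p hp, hPu p hp] at h1
    simp at h1
  have hQu : ∀ p ∈ D, pd Eu (fun q => (φ q).2.1) p = 0 := fun p hp =>
    h.space_projectable hO hφ hθ hPx hPu hp (hPt p hp)
  have hQx : ∀ p ∈ D, pd Ex (fun q => (φ q).2.1) p ≠ 0 := fun p hp h0 => by
    obtain ⟨e, h1, h2, -⟩ := hφ.exists_direction hO hp (0, 1, 0)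
    rw [pd_total, hPx p hp, hPu p hp] at h1
    have e1 : e.1 = 0 := (mul_eq_zero.1 (by simpa using h1)).resolve_right (hPt p hp)
    rw [pd_total, e1, h0, hQu p hp] at h2
    simp at h2
  have hRuu : ∀ p ∈ D, pd Eu (pd Eu (fun q => (φ q).2.2)) p = 0 := fun p hp =>
    h.affine_in_u (z := base p) (m := p.2.2) hO hφ hθ' hPx hPu hQu hp (hPt p hp) (hQx p hp)
  have cR := fun p (hp : p ∈ D) => hφ.contDiffAt_snd_snd hO hp
  obtain ⟨T, sT, hT⟩ := exists_time_of_pd_eq_zero hD (fun p hp => hφ.contDiffAt_fst hO hp) hPx hPu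
  obtain ⟨X, sX, hX⟩ := exists_base_of_pd_eq_zero hD
    (fun p hp => hφ.contDiffAt_snd_fst hO hp) hQu
  obtain ⟨U1, s1, h1⟩ := exists_base_of_pd_eq_zero hD
    (fun p hp => contDiffAt_pd (e := Eu) (m := ∞) (cR p hp) le_rfl) hRuu
  have c1 := fun p (hp : p ∈ D) => contDiffAt_of_mem_base hO s1 (mem_image_of_mem base hp)
  have cb : ∀ p, ContDiffAt ℝ ∞ base p := fun p => by unfold base; fun_prop
  have c1' : ∀ p ∈ D, ContDiffAt ℝ ∞ (fun q => -(U1 (base q))) p := fun p hp =>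
    ((c1 p hp).comp p (cb p)).neg
  have cu : ∀ p, ContDiffAt ℝ ∞ (fun q : Total => q.2.2) p := fun p => by fun_prop
  obtain ⟨U0, s0, h0⟩ := exists_base_of_pd_eq_zero hD
    (F := fun q => (φ q).2.2 + -(U1 (base q)) * q.2.2)
    (fun p hp => (cR p hp).add ((c1' p hp).mul (cu p))) (fun p hp => by
      have ds := (c1 p hp).differentiableAt (by simp)
      have d1 := (c1' p hp).differentiableAt (by simp)
      have du := (cu p).differentiableAt (by simp)
      have hneg : pd Eu (fun q => -(U1 (base q))) p = 0 := by
        rw [pd_comp_base (f := fun z => -(U1 z)) ds.neg]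
        simp
      rw [pd_add ((cR p hp).differentiableAt (by simp)) (d1.fun_mul du), pd_mul d1 du, hneg, pd_u,
        h1 p hp]
      ring)
  refine ⟨T, X, U1, U0, sT, sX, s1, s0, fun p hp => ?_⟩
  refine Prod.ext (hT p hp) (Prod.ext (hX p hp) ?_)
  have := h0 p hp
  simp only at this ⊢
  linear_combination this

/-- The coefficient of `u`, so far a function `V` of `(t, x)`, has `V_x = 0` by
`Connects.determining` and therefore descends to a function of `t`. -/
lemma Connects.exists_hasForm (hD : IsFibredDomain D) (hφ : IsPointTransformation D φ)
    (hθ : θ.InClass (base '' D)) (hθ' : θ'.InClass (base '' (φ '' D))) (h : Connects D φ θ θ') :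
    ∃ (T : ℝ → ℝ) (X : Base → ℝ) (U1 : ℝ → ℝ) (U0 : Base → ℝ),
      HasForm D φ T X U1 U0 ∧ Determining θ (base '' D) X U1 U0 := by
  have hO := hD.isOpen
  obtain ⟨T, X, V, U0, hF⟩ := h.exists_isAffineForm hD hφ hθ hθ'
  have cV := fun z (hz : z ∈ base '' D) => contDiffAt_of_mem_base hO hF.smooth_U1 hz
  have cb : ∀ p, ContDiffAt ℝ ∞ base p := fun p => by unfold base; fun_prop
  obtain ⟨U1, s1, h1⟩ := exists_time_of_pd_eq_zero hD (F := fun q => V (base q))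
    (fun p hp => (cV _ ⟨p, hp, rfl⟩).comp p (cb p))
    (fun p hp => by
      rw [pd_comp_base ((cV _ ⟨p, hp, rfl⟩).differentiableAt (by simp)),
        (h.determining hO hφ hθ hF ⟨p, hp, rfl⟩).2.2.1]
      simp)
    (fun p hp => by
      rw [pd_comp_base ((cV _ ⟨p, hp, rfl⟩).differentiableAt (by simp))]
      simp)
  have hV : ∀ z ∈ base '' D, V z = U1 z.1 := by
    rintro _ ⟨p, hp, rfl⟩
    exact h1 p hp
  have cX := fun z (hz : z ∈ base '' D) => contDiffAt_of_mem_base hO hF.smooth_X hz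
  have c0 := fun z (hz : z ∈ base '' D) => contDiffAt_of_mem_base hO hF.smooth_U0 hz
  refine ⟨T, X, U1, U0, ⟨hF.smooth_T, hF.smooth_X, s1, hF.smooth_U0, ?_, ?_⟩, ?_, ?_, ?_⟩
  · intro z hz
    obtain ⟨nT, nX, nU⟩ := hF.nondegenerate hO hφ hz
    rw [dx_eq_of_smooth (cX z hz), ← hV z hz]
    exact mul_ne_zero (mul_ne_zero nT nX) nU
  · intro t x u hp
    rw [hF.eq _ hp, hV _ ⟨_, hp, rfl⟩]
    rfl
  · intro z hz
    obtain ⟨-, -, nU⟩ := hF.nondegenerate hO hφ hz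
    obtain ⟨-, -, -, h4, -⟩ := h.determining hO hφ hθ hF hz
    rw [dx_eq_of_smooth (cX z hz), dx_dx_eq_of_smooth (cX z hz), dt_eq_of_smooth (cX z hz),
      ← hV z hz]
    field_simp
    linear_combination h4
  · intro z hz
    obtain ⟨-, -, -, -, h5, -⟩ := h.determining hO hφ hθ hF hz
    rw [dx_eq_of_smooth (c0 z hz), h5, pd_eq_of_eqOn (isOpen_base_image hO) hV hz,
      pd_comp_fst ((contDiffAt_of_mem_fst hO s1 (fst_mem_of_mem_base hz)).differentiableAt
        (by simp)), mul_one]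
  · intro z hz
    obtain ⟨-, -, -, -, -, h6⟩ := h.determining hO hφ hθ hF hz
    rw [dt_eq_of_smooth (c0 z hz), dx_dx_eq_of_smooth (c0 z hz), h6]

end

end VarBurgers

/-- Let `φ` be a point transformation on `D` and let `θ` be the arbitrary elements of an equation
of the class. Then `φ` connects this equation to some equation of the class if and only if `φ` has
the stated form with parameters satisfying the determining equations; and in that case the
equations of the class that it connects it to are exactly those whose arbitrary elements are given
by the stated formulas. -/
theorem mainTheorem7 (D : Set VarBurgers.Total) (hD : VarBurgers.IsFibredDomain D)
    (φ : VarBurgers.Total → VarBurgers.Total) (hφ : VarBurgers.IsPointTransformation D φ)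
    (θ : VarBurgers.Coeffs) (hθ : θ.InClass (VarBurgers.base '' D)) :
    ((∃ θ' : VarBurgers.Coeffs,
        θ'.InClass (VarBurgers.base '' (φ '' D)) ∧ VarBurgers.Connects D φ θ θ') ↔
      ∃ (T : ℝ → ℝ) (X : VarBurgers.Base → ℝ) (U1 : ℝ → ℝ) (U0 : VarBurgers.Base → ℝ),
        VarBurgers.HasForm D φ T X U1 U0 ∧
          VarBurgers.Determining θ (VarBurgers.base '' D) X U1 U0) ∧
    (∀ (T : ℝ → ℝ) (X : VarBurgers.Base → ℝ) (U1 : ℝ → ℝ) (U0 : VarBurgers.Base → ℝ),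
      VarBurgers.HasForm D φ T X U1 U0 →
      VarBurgers.Determining θ (VarBurgers.base '' D) X U1 U0 →
      ∀ θ' : VarBurgers.Coeffs, θ'.InClass (VarBurgers.base '' (φ '' D)) →
        (VarBurgers.Connects D φ θ θ' ↔
          VarBurgers.Related θ θ' (VarBurgers.base '' D) T X U1)) := by
  refine ⟨⟨?_, ?_⟩, ?_⟩
  · rintro ⟨θ', hθ', h⟩
    exact h.exists_hasForm hD hφ hθ hθ'
  · rintro ⟨T, X, U1, U0, hF, hdet⟩
    obtain ⟨θ', hθ', hr⟩ := hF.exists_related hD hφ hθ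
    exact ⟨θ', hθ', (hF.connects_iff_related hD.isOpen hφ hθ hdet).2 hr⟩
  · intro T X U1 U0 hF hdet θ' _
    exact hF.connects_iff_related hD.isOpen hφ hθ hdet
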